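/- Let $\ell>0$. A smooth solution $\gamma:\mathbb{R}\times(\mathbb{R}/\ell\mathbb{Z})\to\mathbb{R}^3$ of the binormal curvature flow is a smooth map with $|\partial_s\gamma(t,s)|=1$ and $$\partial_t\gamma=\partial_s\gamma\times\partial_{ss}\gamma$$ for all $t\in\mathbb{R}$, $s\in\mathbb{R}/\ell\mathbb{Z}$; with it are associated, for each $t\in\mathbb{R}$, the distributions (currents) $$T_{\gamma,t}(X):=\int_0^\ell X(\gamma(t,s))\cdot\partial_s\gamma(t,s)\,ds,\qquad X\in\mathcal{D}(\mathbb{R}^3,\mathbb{R}^3).$$ Let $\gamma:\mathbb{R}\times(\mathbb{R}/\ell\mathbb{Z})\to\mathbb{R}^3$ be such a smooth solution that is a traveling circle at speed $\frac{2\pi}{\ell}$, i.e. $\gamma(t,s)=\gamma(0,s)+\frac{2\pi}{\ell}\,t\,\vec e$, where $\vec e$ is a unit vector and $\gamma(0,\cdot)$ parametrizes a circle of radius $r=\frac{\ell}{2\pi}$ in a plane perpendicular to $\vec e$. For $m>1$ set $a_m:=\frac12\left(\frac3m-m\right)$. Then for every $m>1$ there exist numbers $\ell_n>0$ and smooth solutions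 $\gamma_n:\mathbb{R}\times(\mathbb{R}/\ell_n\mathbb{Z})\to\mathbb{R}^3$, $n\in\mathbb{N}$, of the binormal curvature flow such that $\ell_n\to m\ell$ and, for every $t\in\mathbb{R}$, $$T_{\gamma_n,t}\rightharpoonup T_{\gamma,a_mt}\quad\text{in }\mathcal{D}'(\mathbb{R}^3,\mathbb{R}^3)\quad\text{as }n\to+\infty,$$ that is, $T_{\gamma_n,t}(X)\to T_{\gamma,a_mt}(X)$ for every $X\in\mathcal{D}(\mathbb{R}^3,\mathbb{R}^3)$. -/

import Mathlib

open scoped ContDiff Matrix InnerProductSpace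

noncomputable section

namespace BinormalFlow

/-- Euclidean three-space. -/
abbrev E3 : Type := EuclideanSpace ℝ (Fin 3)

/-- The vector product of `ℝ³`, on `EuclideanSpace ℝ (Fin 3)`. -/
def cross (x y : E3) : E3 := WithLp.toLp 2 (crossProduct x.ofLp y.ofLp)

/-- `γ : ℝ × (ℝ/ℓℤ) → ℝ³` is a smooth solution of the binormal curvature flow
`∂ₜγ = ∂ₛγ × ∂ₛₛγ` in arc-length parametrization. Functions on `ℝ/ℓℤ` are `ℓ`-periodic functions
on `ℝ`; the first argument of `γ` is the time, the second one the arc-length parameter. -/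
structure IsSmoothSolution (ℓ : ℝ) (γ : ℝ → ℝ → E3) : Prop where
  smooth : ContDiff ℝ ∞ (fun p : ℝ × ℝ => γ p.1 p.2)
  periodic : ∀ t, Function.Periodic (γ t) ℓ
  arclength : ∀ t s, ‖deriv (γ t) s‖ = 1
  flow : ∀ t s, deriv (fun τ => γ τ s) t = cross (deriv (γ t) s) (deriv (deriv (γ t)) s)

/-- The circle of center `c` and radius `r` in the plane through `c` perpendicular to `e`. -/
def circle (c e : E3) (r : ℝ) : Set E3 := {x | ⟪x - c, e⟫_ℝ = 0 ∧ ‖x - c‖ = r}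

/-- `γ` is a circle of radius `r` that travels at speed `1 / r` in the direction of a unit vector `e`
orthogonal to its plane: `γ(t,s) = γ(0,s) + (t / r) e`, where `γ(0,·)` parametrizes the circle. -/
def IsTravelingCircle (r : ℝ) (γ : ℝ → ℝ → E3) : Prop :=
  ∃ c e : E3, ‖e‖ = 1 ∧ Set.range (γ 0) = circle c e r ∧
    ∀ t s, γ t s = γ 0 s + (t / r) • e

/-- Smooth compactly supported vector fields on `ℝ³`. -/
abbrev TestField : Type := TestFunction (⊤ : TopologicalSpace.Opens E3) E3 ⊤

/-- The current `T_{γ,t}(X) = ∫₀^ℓ X(γ(t,s)) · ∂ₛγ(t,s) ds`. -/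
def current (ℓ : ℝ) (γ : ℝ → ℝ → E3) (t : ℝ) (X : TestField) : ℝ :=
  ∫ s in (0 : ℝ)..ℓ, ⟪X (γ t s), deriv (γ t) s⟫_ℝ

/-- Convergence in the sense of distributions: convergence against each test field. -/
def TendstoDistrib (T : ℕ → TestField → ℝ) (S : TestField → ℝ) : Prop :=
  ∀ X : TestField, Filter.Tendsto (fun n => T n X) Filter.atTop (nhds (S X))

/-- The factor `a_m = (3 / m - m) / 2`. -/
def slowFactor (m : ℝ) : ℝ := (1 / 2) * (3 / m - m)

end BinormalFlow

end

/-! The approximating curves are thin coils wound `n` times around the circle. A coil is close to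
the circle only uniformly, not in its tangents, so it may be `m` times longer; yet two uniformly
close closed curves of bounded length have close currents, by an integration by parts
(`abs_work_sub_work_le`). It remains to find coils that move rigidly, with vertical velocity `a_m`
in units where the circle has radius and speed 1.

A curve that rotates about an axis, translates along it and slides along itself has a squared radius
`u` with `u'²` a cubic in `u`. If the roots are `A ± q` and `A - 1`, then `u = A + q cos φ` with `φ'
= Ω √(1 + q cos φ)`, and angle and height follow by quadrature (`exists_isHelicalProfile`). Two
closing conditions remain. The height is periodic when `drift q` is the right quotient of integrals.
The angle advances by `q * angleInt v q` per period, which must equal `2π / n`; for large `n` the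
intermediate value theorem provides a small `q`.

All normalized quantities extend continuously to `q = 0`. There the free parameter `v` is tuned so
that the length tends to `2πm`, and the velocity then tends to `(3/m - m)/2`
(`exists_isHelicalProfile_near`). The angular velocity `Ω` is of order `1/q`, but rotation and
sliding only shift the angle along the limit circle, which its current does not see. -/

noncomputable section

namespace BinormalFlow

open Real Filter Topology

/-! ### Autonomous equations with periodic right-hand side -/

section PeriodicODE

/-- Solutions of autonomous scalar equations with smooth right-hand side are smooth. -/
theorem contDiff_of_hasDerivAt_comp {f φ : ℝ → ℝ} (hf : ContDiff ℝ ∞ f)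
    (hφ : ∀ s, HasDerivAt φ (f (φ s)) s) : ContDiff ℝ ∞ φ := by
  have hd : deriv φ = f ∘ φ := funext fun s => (hφ s).deriv
  have hdiff : Differentiable ℝ φ := fun s => (hφ s).differentiableAt
  have key : ∀ n : ℕ, ContDiff ℝ n φ := by
    intro n
    induction n with
    | zero => exact contDiff_zero.2 hdiff.continuous
    | succ n ih =>
      have h : ContDiff ℝ ((n : WithTop ℕ∞) + 1) φ := by
        rw [contDiff_succ_iff_deriv]
        refine ⟨hdiff, by simp, ?_⟩
        rw [hd]
        exact (hf.of_le (by exact_mod_cast le_top)).comp ih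
      exact_mod_cast h
  exact contDiff_infty.2 key

theorem contDiff_of_hasDerivAt_contDiff {y g : ℝ → ℝ} (hg : ContDiff ℝ ∞ g)
    (hy : ∀ s, HasDerivAt y (g s) s) : ContDiff ℝ ∞ y := by
  rw [contDiff_infty_iff_deriv]
  refine ⟨fun s => (hy s).differentiableAt, ?_⟩
  rwa [show deriv y = g from funext fun s => (hy s).deriv]

/-- The primitive of a periodic function increases by the integral over a period. -/
theorem integral_add_period {k : ℝ → ℝ} (hk : Continuous k) {T : ℝ} (hper : Function.Periodic k T)
    (x : ℝ) : ∫ y in (0 : ℝ)..(x + T), k y = (∫ y in (0 : ℝ)..x, k y) + ∫ y in (0 : ℝ)..T, k y := by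
  have h := intervalIntegral.integral_add_adjacent_intervals
    (hk.intervalIntegrable (μ := MeasureTheory.volume) 0 x) (hk.intervalIntegrable x (x + T))
  rw [← h, hper.intervalIntegral_add_eq x 0, zero_add]

/-- An autonomous equation with positive periodic right-hand side has a global solution, which
advances by one period of the right-hand side in the time `∫₀ᵀ 1 / f`. -/
theorem exists_solution_periodic {f : ℝ → ℝ} (hf : Continuous f) (hpos : ∀ x, 0 < f x) {T : ℝ}
    (hT : 0 < T) (hper : Function.Periodic f T) :
    ∃ φ : ℝ → ℝ, φ 0 = 0 ∧ (∀ s, HasDerivAt φ (f (φ s)) s) ∧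
      ∀ s, φ (s + ∫ y in (0 : ℝ)..T, 1 / f y) = φ s + T := by
  have hk : Continuous fun y => 1 / f y := continuous_const.div hf fun x => (hpos x).ne'
  have hkpos : ∀ y, 0 < 1 / f y := fun y => one_div_pos.2 (hpos y)
  have hkper : Function.Periodic (fun y => 1 / f y) T := fun y => by simp only [hper y]
  -- Separation of variables: the solution is the inverse of the time map `P`, a bijection because
  -- the integrand is positive and periodic.
  set P : ℝ → ℝ := fun x => ∫ y in (0 : ℝ)..x, 1 / f y with hP
  have hPd : ∀ x, HasDerivAt P (1 / f x) x := fun x => hk.integral_hasStrictDerivAt 0 x |>.hasDerivAt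
  have hmono : StrictMono P := strictMono_of_hasDerivAt_pos hPd hkpos
  have hcont : Continuous P := continuous_iff_continuousAt.2 fun x => (hPd x).continuousAt
  have hint : ∀ a b, IntervalIntegrable (fun y => 1 / f y) MeasureTheory.volume a b :=
    fun a b => hk.intervalIntegrable a b
  have hsurj : Function.Surjective P := hcont.surjective
    (hkper.tendsto_atTop_intervalIntegral_of_pos' (hint 0 T) hkpos hT)
    (hkper.tendsto_atBot_intervalIntegral_of_pos' (hint 0 T) hkpos hT)
  let e := (hmono.orderIsoOfSurjective P hsurj).toHomeomorph
  have he : ∀ x, P (e.symm x) = x := fun x => e.apply_symm_apply x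
  refine ⟨e.symm, ?_, ?_, ?_⟩
  · apply hmono.injective
    rw [he]
    simp [hP]
  · intro s
    have h := HasDerivAt.of_local_left_inverse (f := P) (g := e.symm) (a := s)
      e.symm.continuous.continuousAt (hPd (e.symm s)) (hkpos _).ne' (Eventually.of_forall he)
    simpa using h
  · intro s
    apply hmono.injective
    rw [he]
    change _ = ∫ y in (0 : ℝ)..(e.symm s + T), 1 / f y
    rw [integral_add_period hk hkper]
    change _ = P (e.symm s) + _
    rw [he]

/-- Quadrature along a solution of an autonomous periodic equation. -/
theorem exists_quadrature {f h φ : ℝ → ℝ} (hf : Continuous f) (hpos : ∀ x, 0 < f x)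
    (hh : Continuous h) {T s₀ : ℝ} (hfper : Function.Periodic f T) (hhper : Function.Periodic h T)
    (hφ0 : φ 0 = 0) (hφ : ∀ s, HasDerivAt φ (f (φ s)) s) (hφT : ∀ s, φ (s + s₀) = φ s + T) :
    ∃ y : ℝ → ℝ, y 0 = 0 ∧ (∀ s, HasDerivAt y (h (φ s)) s) ∧
      ∀ s, y (s + s₀) = y s + ∫ x in (0 : ℝ)..T, h x / f x := by
  have hk : Continuous fun y => h y / f y := hh.div hf fun x => (hpos x).ne'
  have hkper : Function.Periodic (fun y => h y / f y) T := fun y => by simp only [hfper y, hhper y]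
  -- Substituting `x = φ s` turns time into phase, so the increment over a period is an explicit
  -- integral.
  refine ⟨fun s => ∫ x in (0 : ℝ)..(φ s), h x / f x, by simp [hφ0], fun s => ?_, fun s => ?_⟩
  · have h1 := (hk.integral_hasStrictDerivAt 0 (φ s)).hasDerivAt.comp s (hφ s)
    have h2 : h (φ s) / f (φ s) * f (φ s) = h (φ s) := div_mul_cancel₀ _ (hpos _).ne'
    rw [h2] at h1
    exact h1
  · simp only [hφT]
    exact integral_add_period hk hkper _

end PeriodicODE

/-! ### Normalized parameters of the coil and their values at `q = 0` -/

section Parameters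

/-- The function `√(1 + q cos x)`, truncated away from zero. -/
def rad (q x : ℝ) : ℝ := √(max (1 + q * cos x) (1 / 2))

theorem rad_pos (q x : ℝ) : 0 < rad q x := by unfold rad; positivity

theorem continuous_rad : Continuous fun p : ℝ × ℝ => rad p.1 p.2 := by
  unfold rad; fun_prop

theorem rad_zero (x : ℝ) : rad 0 x = 1 := by
  unfold rad; norm_num

theorem half_le_one_add_mul_cos {q : ℝ} (h0 : 0 ≤ q) (h1 : q ≤ 1 / 2) (x : ℝ) :
    1 / 2 ≤ 1 + q * cos x := by
  nlinarith [neg_one_le_cos x]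

theorem rad_eq {q : ℝ} (h0 : 0 ≤ q) (h1 : q ≤ 1 / 2) (x : ℝ) : rad q x = √(1 + q * cos x) := by
  rw [rad, max_eq_left (half_le_one_add_mul_cos h0 h1 x)]

theorem rad_sq {q : ℝ} (h0 : 0 ≤ q) (h1 : q ≤ 1 / 2) (x : ℝ) : rad q x ^ 2 = 1 + q * cos x := by
  rw [rad_eq h0 h1, sq_sqrt]
  linarith [half_le_one_add_mul_cos h0 h1 x]

theorem contDiff_rad {q : ℝ} (h0 : 0 ≤ q) (h1 : q ≤ 1 / 2) : ContDiff ℝ ∞ (rad q) := by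
  rw [show rad q = fun x => √(1 + q * cos x) from funext (rad_eq h0 h1)]
  refine ContDiff.sqrt (by fun_prop) fun x => ?_
  linarith [half_le_one_add_mul_cos h0 h1 x]

theorem periodic_rad (q : ℝ) : Function.Periodic (rad q) (2 * π) := fun x => by
  simp [rad]

/-- The integral of `1 / √(1 + q cos x)` over a period. -/
def radInt (q : ℝ) : ℝ := ∫ x in (0 : ℝ)..(2 * π), 1 / rad q x

/-- The negative of the first cosine coefficient of `1 / √(1 + q cos x)`, divided by `q`. -/
def cosInt (q : ℝ) : ℝ := ∫ x in (0 : ℝ)..(2 * π), cos x ^ 2 / (rad q x * (1 + rad q x))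

theorem continuous_radInt : Continuous radInt := by
  unfold radInt
  refine intervalIntegral.continuous_parametric_intervalIntegral_of_continuous' ?_ _ _
  exact continuous_const.div continuous_rad fun p => (rad_pos _ _).ne'

theorem continuous_cosInt : Continuous cosInt := by
  unfold cosInt
  refine intervalIntegral.continuous_parametric_intervalIntegral_of_continuous' ?_ _ _
  refine Continuous.div (by fun_prop)
    (continuous_rad.mul (continuous_const.add continuous_rad)) fun p => ?_
  have := rad_pos p.1 p.2
  positivity

theorem radInt_pos (q : ℝ) : 0 < radInt q := by
  refine intervalIntegral.intervalIntegral_pos_of_pos ?_ (fun x => one_div_pos.2 (rad_pos q x))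
    (by positivity)
  refine Continuous.intervalIntegrable ?_ _ _
  exact continuous_const.div (continuous_rad.comp (Continuous.prodMk_right q))
    fun p => (rad_pos _ _).ne'

theorem cosInt_nonneg (q : ℝ) : 0 ≤ cosInt q := by
  refine intervalIntegral.integral_nonneg (by positivity) fun x _ => ?_
  have := rad_pos q x
  positivity

theorem radInt_zero : radInt 0 = 2 * π := by
  simp [radInt, rad_zero]

theorem cosInt_zero : cosInt 0 = π / 2 := by
  have h : cosInt 0 = ∫ x in (0 : ℝ)..(2 * π), cos x ^ 2 / 2 := by
    unfold cosInt
    congr 1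
    ext x
    rw [rad_zero]
    norm_num
  rw [h, intervalIntegral.integral_div, integral_cos_sq]
  simp

theorem continuous_rad_right (q : ℝ) : Continuous (rad q) :=
  continuous_rad.comp (Continuous.prodMk_right q)

/-- Subtract `cos x`, which has mean zero: by `rad² - 1 = q cos x`, the difference `1 / rad - 1`
carries a factor `q`. Extracting it makes `drift` continuous at `q = 0`. -/
theorem integral_cos_div_rad {q : ℝ} (h0 : 0 ≤ q) (h1 : q ≤ 1 / 2) :
    ∫ x in (0 : ℝ)..(2 * π), cos x / rad q x = -q * cosInt q := by
  have hc := continuous_rad_right q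
  have h : ∀ x, cos x / rad q x = cos x - q * (cos x ^ 2 / (rad q x * (1 + rad q x))) := by
    intro x
    have h1' := rad_pos q x
    have h2 := rad_sq h0 h1 x
    field_simp
    linear_combination (-cos x) * h2
  simp_rw [h]
  rw [intervalIntegral.integral_sub, intervalIntegral.integral_const_mul, integral_cos]
  · simp [cosInt]
  · exact continuous_cos.intervalIntegrable _ _
  · refine Continuous.intervalIntegrable ?_ _ _
    refine continuous_const.mul (Continuous.div (by fun_prop) (by fun_prop) fun x => ?_)
    have := rad_pos q x
    positivity

/-- The quotient of `cosInt` and `radInt`, which fixes the mean vertical drift. -/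
def drift (q : ℝ) : ℝ := cosInt q / radInt q

/-- The third root of the cubic of the profile, divided by `-q ^ 2`. -/
def thirdRoot (v q : ℝ) : ℝ := v ^ 2 + 2 * drift q

/-- The mean value of the squared radius. -/
def meanSq (v q : ℝ) : ℝ := 1 - q ^ 2 * thirdRoot v q

/-- The normalized angular momentum. -/
def angMom (v q : ℝ) : ℝ := √((meanSq v q ^ 2 - q ^ 2) * thirdRoot v q) / 2

/-- The normalization by arc-length. -/
def speedSq (v q : ℝ) : ℝ :=
  q ^ 2 * drift q ^ 2 / 4 + meanSq v q * (v ^ 2 + drift q) / 2 + v * angMom v q + 1 / 4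

/-- The normalized angle swept by the profile over a period. -/
def angleInt (v q : ℝ) : ℝ := ∫ x in (0 : ℝ)..(2 * π),
  (v / 2 + angMom v q / max (meanSq v q + q * cos x) (1 / 2)) / rad q x

theorem continuous_drift : Continuous drift :=
  continuous_cosInt.div continuous_radInt fun q => (radInt_pos q).ne'

theorem drift_nonneg (q : ℝ) : 0 ≤ drift q := div_nonneg (cosInt_nonneg q) (radInt_pos q).le

theorem continuous_thirdRoot (v : ℝ) : Continuous (thirdRoot v) := by
  have := continuous_drift
  unfold thirdRoot; fun_prop

theorem thirdRoot_nonneg (v q : ℝ) : 0 ≤ thirdRoot v q := by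
  have := drift_nonneg q
  unfold thirdRoot; positivity

theorem continuous_meanSq (v : ℝ) : Continuous (meanSq v) := by
  have := continuous_thirdRoot v
  unfold meanSq; fun_prop

theorem continuous_angMom (v : ℝ) : Continuous (angMom v) := by
  have := continuous_thirdRoot v
  have := continuous_meanSq v
  unfold angMom; fun_prop

theorem continuous_speedSq (v : ℝ) : Continuous (speedSq v) := by
  have := continuous_drift
  have := continuous_meanSq v
  have := continuous_angMom v
  unfold speedSq; fun_prop

theorem continuous_angleInt (v : ℝ) : Continuous (angleInt v) := by
  have h1 := continuous_meanSq v
  have h2 := continuous_angMom v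
  unfold angleInt
  refine intervalIntegral.continuous_parametric_intervalIntegral_of_continuous' ?_ _ _
  refine Continuous.div ?_ continuous_rad fun p => (rad_pos _ _).ne'
  refine continuous_const.add (Continuous.div (by fun_prop) (by fun_prop) fun p => ?_)
  positivity

theorem drift_zero : drift 0 = 1 / 4 := by
  rw [drift, radInt_zero, cosInt_zero]
  field_simp
  norm_num

theorem meanSq_zero (v : ℝ) : meanSq v 0 = 1 := by simp [meanSq]

/-- The root at `q = 0` is `√(v² + 1/2)`; writing `v = (S - 1/(2S))/2` makes the radicand the square
of `(S + 1/(2S))/2`, so that `S = v + √(v² + 1/2)`. -/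
theorem angMom_zero {S : ℝ} (hS : 0 < S) :
    angMom ((S - 1 / (2 * S)) / 2) 0 = (S + 1 / (2 * S)) / 4 := by
  have h : (meanSq ((S - 1 / (2 * S)) / 2) 0 ^ 2 - 0 ^ 2) * thirdRoot ((S - 1 / (2 * S)) / 2) 0
      = ((S + 1 / (2 * S)) / 2) ^ 2 := by
    rw [meanSq_zero, thirdRoot, drift_zero]
    field_simp
    ring
  rw [angMom, h, sqrt_sq (by positivity)]
  ring

theorem speedSq_zero {S : ℝ} (hS : 0 < S) :
    speedSq ((S - 1 / (2 * S)) / 2) 0 = (1 + S ^ 2) / 4 := by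
  rw [speedSq, angMom_zero hS, meanSq_zero, drift_zero]
  field_simp
  ring

theorem angleInt_zero {S : ℝ} (hS : 0 < S) :
    angleInt ((S - 1 / (2 * S)) / 2) 0 = π * S := by
  simp only [angleInt, angMom_zero hS, meanSq_zero, rad_zero]
  norm_num
  field_simp
  ring

end Parameters

/-! ### Helical profiles by quadrature -/

section Profile

/-- The profile, in cylindrical coordinates and arc-length parametrization, of a curve that moves
rigidly under the binormal curvature flow. Here `u` is the squared distance to the axis, `θ` the
angle and `z` the height. -/
structure IsHelicalProfile (Ω V K M s₀ δ : ℝ) (u θ z : ℝ → ℝ) : Prop where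
  smooth : ContDiff ℝ ∞ u
  pos : ∀ s, 0 < u s
  hasDerivAt_angle : ∀ s, HasDerivAt θ (V / 2 + M / u s) s
  hasDerivAt_height : ∀ s, HasDerivAt z (K - Ω * u s / 2) s
  energy : ∀ s, deriv u s ^ 2
    = 4 * (u s * (1 - (K - Ω * u s / 2) ^ 2) - (V * u s / 2 + M) ^ 2)
  acceleration : ∀ s, deriv (deriv u) s = 2 * (1 - (K - Ω * u s / 2) ^ 2)
    + 2 * u s * Ω * (K - Ω * u s / 2) - 2 * V * (V * u s / 2 + M)
  periodic : Function.Periodic u s₀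
  angle_add : ∀ s, θ (s + s₀) = θ s + δ
  periodic_height : Function.Periodic z s₀
  angle_zero : θ 0 = 0
  height_zero : z 0 = 0

/-- The energy equation says that its cubic in `u` equals `Ω² (q² - (u - A)²)(u - A + 1)`. With `V =
Ω q v`, the constant coefficient fixes `M` (hence `angMom`), the quadratic one fixes `A = meanSq`,
and the linear one gives `Ω² q² Q² = 1`, with `Q² = speedSq`. -/
theorem exists_isHelicalProfile {v q : ℝ} (h0 : 0 < q) (h1 : q ≤ 1 / 2)
    (hA : 1 / 2 ≤ meanSq v q - q) (hQ : 0 < speedSq v q) :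
    ∃ Ω K M : ℝ, ∃ u θ z : ℝ → ℝ,
      IsHelicalProfile Ω (v / √(speedSq v q)) K M (q * √(speedSq v q) * radInt q)
        (q * angleInt v q) u θ z ∧ ∀ s, |u s - 1| ≤ q ^ 2 * thirdRoot v q + q := by
  set Q := √(speedSq v q) with hQdef
  have hQpos : 0 < Q := sqrt_pos.2 hQ
  have hQsq : Q ^ 2 = speedSq v q := sq_sqrt hQ.le
  set A := meanSq v q with hAdef
  set H := drift q with hH
  set μ := angMom v q with hμ
  have hAW : A = 1 - q ^ 2 * (v ^ 2 + 2 * H) := rfl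
  have hμsq : μ ^ 2 = (A ^ 2 - q ^ 2) * (v ^ 2 + 2 * H) / 4 := by
    have hn : 0 ≤ (A ^ 2 - q ^ 2) * (v ^ 2 + 2 * H) :=
      mul_nonneg (by nlinarith) (thirdRoot_nonneg v q)
    rw [hμ, angMom, div_pow]
    change √((A ^ 2 - q ^ 2) * (v ^ 2 + 2 * H)) ^ 2 / 2 ^ 2 = _
    rw [sq_sqrt hn]
    norm_num
  have hQ' : Q ^ 2 = q ^ 2 * H ^ 2 / 4 + A * (v ^ 2 + H) / 2 + v * μ + 1 / 4 := hQsq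
  set Ω := 1 / (q * Q) with hΩ
  have hΩpos : 0 < Ω := by positivity
  have hΩq : Ω * q * Q = 1 := by rw [hΩ]; field_simp
  have hΩsq : Ω ^ 2 * q ^ 2 * (q ^ 2 * H ^ 2 / 4 + A * (v ^ 2 + H) / 2 + v * μ + 1 / 4) = 1 := by
    rw [← hQ']
    linear_combination (Ω * q * Q + 1) * hΩq
  have hV : v / Q = Ω * q * v := by rw [hΩ]; field_simp
  rw [hV]
  have hrad : ContDiff ℝ ∞ (rad q) := contDiff_rad h0.le h1
  set f : ℝ → ℝ := fun x => Ω * rad q x with hf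
  have hfs : ContDiff ℝ ∞ f := contDiff_const.mul hrad
  have hfpos : ∀ x, 0 < f x := fun x => mul_pos hΩpos (rad_pos q x)
  have hfper : Function.Periodic f (2 * π) := fun x => by simp only [hf, periodic_rad q x]
  obtain ⟨φ, hφ0, hφ, hφT⟩ := exists_solution_periodic hfs.continuous hfpos (by positivity) hfper
  have hs0 : ∫ y in (0 : ℝ)..(2 * π), 1 / f y = q * Q * radInt q := by
    rw [radInt, ← intervalIntegral.integral_const_mul]
    congr 1
    ext y
    have := rad_pos q y
    simp only [hf, hΩ]
    field_simp
  rw [hs0] at hφT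
  have hφs : ContDiff ℝ ∞ φ := contDiff_of_hasDerivAt_comp hfs hφ
  have hupos : ∀ x, 1 / 2 ≤ A + q * cos x := fun x => by nlinarith [neg_one_le_cos x]
  have hunz : ∀ x, A + q * cos x ≠ 0 := fun x => by linarith [hupos x]
  -- This gives `z' = -(Ω q / 2)(q H + cos φ)`, whose integral over a period vanishes for `H =
  -- cosInt / radInt`.
  set K := Ω * (-(q ^ 2 * H / 2) + A / 2) with hK
  set M := Ω * q * μ with hM
  obtain ⟨θ, hθ0, hθ, hθT⟩ := exists_quadrature (h := fun x => Ω * q * v / 2 + M / (A + q * cos x))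
    hfs.continuous hfpos (continuous_const.add (continuous_const.div (by fun_prop) hunz)) hfper
    (fun x => by simp) hφ0 hφ hφT
  obtain ⟨z, hz0, hz, hzT⟩ := exists_quadrature (h := fun x => K - Ω * (A + q * cos x) / 2)
    hfs.continuous hfpos (by fun_prop) hfper (fun x => by simp) hφ0 hφ hφT
  have hθint : ∫ x in (0 : ℝ)..(2 * π), (Ω * q * v / 2 + M / (A + q * cos x)) / f x
      = q * angleInt v q := by
    rw [angleInt, ← intervalIntegral.integral_const_mul]
    congr 1
    ext x
    have := rad_pos q x
    have h2 := hunz x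
    rw [max_eq_left (hupos x)]
    simp only [hf, hM, hμ]
    field_simp
  have hzint : ∫ x in (0 : ℝ)..(2 * π), (K - Ω * (A + q * cos x) / 2) / f x = 0 := by
    have h : ∀ x, (K - Ω * (A + q * cos x) / 2) / f x
        = (-(q ^ 2 * H / 2)) * (1 / rad q x) + (-(q / 2)) * (cos x / rad q x) := by
      intro x
      have := rad_pos q x
      simp only [hf, hK]
      field_simp
      ring
    have hc := continuous_rad_right q
    have hne : ∀ x, rad q x ≠ 0 := fun x => (rad_pos q x).ne'
    simp_rw [h]
    rw [intervalIntegral.integral_add, intervalIntegral.integral_const_mul,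
      intervalIntegral.integral_const_mul, integral_cos_div_rad h0.le h1]
    · have : cosInt q = H * radInt q := by
        rw [hH, drift, div_mul_cancel₀ _ (radInt_pos q).ne']
      rw [this, ← radInt]
      ring
    · exact (continuous_const.mul (continuous_const.div hc hne)).intervalIntegrable _ _
    · exact (continuous_const.mul (continuous_cos.div hc hne)).intervalIntegrable _ _
  have hu' : ∀ s, HasDerivAt (fun s => A + q * cos (φ s)) (q * (-sin (φ s) * f (φ s))) s :=
    fun s => (((hφ s).cos).const_mul q).const_add A
  -- Since `φ' = f(φ)`, the derivative is `f f' = (f²)'/2` at `φ`, and the square root disappears.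
  have hf' : ∀ s, HasDerivAt (fun s => f (φ s)) (-(Ω ^ 2 * q * sin (φ s)) / 2) s := by
    intro s
    have hfd : HasDerivAt f (Ω * ((-(q * sin (φ s))) / (2 * rad q (φ s)))) (φ s) := by
      have h3 : HasDerivAt (fun x => 1 + q * cos x) (-(q * sin (φ s))) (φ s) := by
        simpa using ((hasDerivAt_cos (φ s)).const_mul q).const_add 1
      have h4 := (h3.sqrt (by linarith [half_le_one_add_mul_cos h0.le h1 (φ s)])).const_mul Ω
      rw [← rad_eq h0.le h1 (φ s)] at h4
      rwa [show f = fun x => Ω * √(1 + q * cos x) from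
        funext fun x => by simp only [hf, rad_eq h0.le h1]]
    have h5 := hfd.comp s (hφ s)
    have h6 := rad_pos q (φ s)
    refine h5.congr_deriv ?_
    simp only [hf]
    field_simp
  have hdu : deriv (fun s => A + q * cos (φ s)) = fun s => q * (-sin (φ s) * f (φ s)) :=
    funext fun s => (hu' s).deriv
  have hfsq : ∀ x, f x ^ 2 = Ω ^ 2 * (1 + q * cos x) := fun x => by
    simp only [hf, mul_pow, rad_sq h0.le h1]
  refine ⟨Ω, K, M, fun s => A + q * cos (φ s), θ, z, ⟨?_, ?_, hθ, hz, ?_, ?_, ?_, ?_, ?_, hθ0, hz0⟩,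
    ?_⟩
  · exact contDiff_const.add (contDiff_const.mul (contDiff_cos.comp hφs))
  · intro s
    linarith [hupos (φ s)]
  · intro s
    simp only [hdu, hK, hM]
    linear_combination q ^ 2 * sin (φ s) ^ 2 * hfsq (φ s)
      + q ^ 2 * Ω ^ 2 * (1 + q * cos (φ s)) * sin_sq_add_cos_sq (φ s)
      + 4 * (A + q * cos (φ s)) * hΩsq + 4 * Ω ^ 2 * q ^ 2 * hμsq
      - q ^ 2 * Ω ^ 2 * (1 - cos (φ s) ^ 2) * hAW
  · intro s
    rw [hdu]
    have h7 : HasDerivAt (fun s => q * (-sin (φ s) * f (φ s))) _ s :=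
      (((hφ s).sin.neg).mul (hf' s)).const_mul q
    rw [h7.deriv]
    simp only [hK, hM, Pi.neg_apply]
    linear_combination -q * cos (φ s) * hfsq (φ s)
      + q ^ 2 * Ω ^ 2 / 2 * sin_sq_add_cos_sq (φ s)
      + 2 * hΩsq + Ω ^ 2 * q * cos (φ s) * hAW
  · intro s
    simp only [hφT, cos_add_two_pi]
  · intro s
    rw [hθT, hθint]
  · intro s
    rw [hzT, hzint, add_zero]
  · intro s
    have h8 := abs_cos_le_one (φ s)
    have h9 := thirdRoot_nonneg v q
    have : A + q * cos (φ s) - 1 = -(q ^ 2 * thirdRoot v q) + q * cos (φ s) := by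
      rw [hAdef, meanSq]; ring
    simp only [this]
    refine (abs_add_le _ _).trans (add_le_add ?_ ?_)
    · rw [abs_neg, abs_of_nonneg (by positivity)]
    · rw [abs_mul, abs_of_pos h0]
      nlinarith

end Profile

/-! ### Closing the coil, and the limit of small amplitude -/

section Existence

/-- There are closed helical profiles winding around the unit circle, arbitrarily close to it, whose
length is close to `2 π m` and whose speed is close to `slowFactor m`. -/
theorem exists_isHelicalProfile_near {m : ℝ} (hm : 1 < m) {ε : ℝ} (hε : 0 < ε) :
    ∃ Ω V K M s₀ : ℝ, ∃ n : ℕ, ∃ u θ z : ℝ → ℝ, 0 < n ∧ 0 < s₀ ∧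
      IsHelicalProfile Ω V K M s₀ (2 * π / n) u θ z ∧ s₀ < ε ∧ |n * s₀ - 2 * π * m| < ε ∧
      |V - slowFactor m| < ε ∧ ∀ s, |u s - 1| < ε := by
  have hm1 : 0 < m ^ 2 - 1 := by nlinarith
  -- At `q = 0` the length tends to `4π √((1 + S²)/4) / S`, which equals `2πm` exactly when `S² (m²
  -- - 1) = 1`.
  set S := 1 / √(m ^ 2 - 1) with hSdef
  have hS : 0 < S := by positivity
  have hSsq : S ^ 2 * (m ^ 2 - 1) = 1 := by
    rw [hSdef, div_pow, sq_sqrt hm1.le]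
    field_simp
  set v := (S - 1 / (2 * S)) / 2 with hv
  have cQ := continuous_speedSq v
  have cW := continuous_thirdRoot v
  have cA := continuous_meanSq v
  have cF := continuous_angleInt v
  have cG := continuous_radInt
  have hQ0 : speedSq v 0 = (m * S / 2) ^ 2 := by
    rw [hv, speedSq_zero hS]
    linear_combination (-1 / 4 : ℝ) * hSsq
  have hQ0s : √(speedSq v 0) = m * S / 2 := by
    rw [hQ0, sqrt_sq (by positivity)]
  have hF0 : angleInt v 0 = π * S := angleInt_zero hS
  have e1 : ∀ᶠ q in 𝓝 (0 : ℝ), q < 1 / 2 := eventually_lt_nhds (by norm_num)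
  have e2 : ∀ᶠ q in 𝓝 (0 : ℝ), 1 / 2 < meanSq v q - q := by
    refine (cA.sub continuous_id).continuousAt.eventually (lt_mem_nhds ?_)
    simp [meanSq_zero]
    norm_num
  have e3 : ∀ᶠ q in 𝓝 (0 : ℝ), 0 < speedSq v q := by
    refine cQ.continuousAt.eventually (lt_mem_nhds ?_)
    rw [hQ0]
    positivity
  have e4 : ∀ᶠ q in 𝓝 (0 : ℝ), 0 < angleInt v q := by
    refine cF.continuousAt.eventually (lt_mem_nhds ?_)
    rw [hF0]
    positivity
  have e5 : ∀ᶠ q in 𝓝 (0 : ℝ), q * √(speedSq v q) * radInt q < ε := by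
    have hc : Continuous fun q => q * √(speedSq v q) * radInt q := by fun_prop
    refine hc.continuousAt.eventually (gt_mem_nhds ?_)
    simpa using hε
  -- Once `n q angleInt = 2π`, this quotient is the length `n s₀`; unlike `n`, it is continuous in
  -- `q` at 0.
  have e6 : ∀ᶠ q in 𝓝 (0 : ℝ),
      |2 * π * √(speedSq v q) * radInt q / angleInt v q - 2 * π * m| < ε := by
    have hc : ContinuousAt
        (fun q => |2 * π * √(speedSq v q) * radInt q / angleInt v q - 2 * π * m|) 0 := by
      refine (ContinuousAt.sub (ContinuousAt.div ?_ cF.continuousAt ?_) continuousAt_const).abs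
      · exact Continuous.continuousAt (by fun_prop)
      · rw [hF0]
        positivity
    refine hc.eventually (gt_mem_nhds ?_)
    have h : 2 * π * (m * S / 2) * (2 * π) / (π * S) - 2 * π * m = 0 := by
      field_simp
      ring
    beta_reduce
    rw [hQ0s, radInt_zero, hF0, h, abs_zero]
    exact hε
  have e7 : ∀ᶠ q in 𝓝 (0 : ℝ), |v / √(speedSq v q) - slowFactor m| < ε := by
    have hc : ContinuousAt (fun q => |v / √(speedSq v q) - slowFactor m|) 0 := by
      refine (ContinuousAt.sub (ContinuousAt.div continuousAt_const ?_ ?_) continuousAt_const).abs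
      · exact Continuous.continuousAt (by fun_prop)
      · rw [hQ0s]
        positivity
    refine hc.eventually (gt_mem_nhds ?_)
    have h : v / (m * S / 2) - slowFactor m = 0 := by
      rw [hv, slowFactor]
      field_simp
      linear_combination hSsq
    beta_reduce
    rw [hQ0s, h, abs_zero]
    exact hε
  have e8 : ∀ᶠ q in 𝓝 (0 : ℝ), q ^ 2 * thirdRoot v q + q < ε := by
    have hc : Continuous fun q => q ^ 2 * thirdRoot v q + q := by fun_prop
    refine hc.continuousAt.eventually (gt_mem_nhds ?_)
    simpa using hε
  obtain ⟨d, hd, hball⟩ := Metric.eventually_nhds_iff.1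
    (e1.and (e2.and (e3.and (e4.and (e5.and (e6.and (e7.and e8)))))))
  have hmem : ∀ q, 0 < q → q ≤ d / 2 → dist q 0 < d := fun q h h' => by
    rw [dist_zero_right, Real.norm_eq_abs, abs_of_pos h]
    linarith
  have hFd : 0 < d / 2 * angleInt v (d / 2) :=
    mul_pos (by positivity) (hball (hmem _ (by positivity) le_rfl)).2.2.2.1
  obtain ⟨n, hn⟩ := exists_nat_gt (2 * π / (d / 2 * angleInt v (d / 2)))
  have hnpos : (0 : ℝ) < n := lt_trans (by positivity) hn
  have hn' : 2 * π / n ≤ d / 2 * angleInt v (d / 2) := by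
    rw [div_lt_iff₀ hFd] at hn
    rw [div_le_iff₀ hnpos]
    linarith
  -- The angle swept per period vanishes at `q = 0` and is at least `2π / n` at `q = d / 2`, by the
  -- choice of `n`.
  have hivt : 2 * π / n ∈ (fun q => q * angleInt v q) '' Set.Icc 0 (d / 2) := by
    refine intermediate_value_Icc (by positivity) (by fun_prop) ⟨?_, hn'⟩
    simp only [zero_mul]
    positivity
  obtain ⟨q, ⟨hq0, hqd⟩, hq⟩ := hivt
  simp only at hq
  have hqpos : 0 < q := by
    rcases hq0.eq_or_lt with h | h
    · rw [← h, zero_mul] at hq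
      have : 0 < 2 * π / n := by positivity
      linarith
    · exact h
  obtain ⟨h1, h2, h3, h4, h5, h6, h7, h8⟩ := hball (hmem q hqpos hqd)
  obtain ⟨Ω, K, M, u, θ, z, hprof, hu⟩ := exists_isHelicalProfile hqpos h1.le h2.le h3
  rw [hq] at hprof
  refine ⟨Ω, _, K, M, _, n, u, θ, z, by exact_mod_cast hnpos, ?_, hprof, h5, ?_, h7,
    fun s => (hu s).trans_lt h8⟩
  · have := radInt_pos q
    positivity
  · have h : (n : ℝ) * (q * √(speedSq v q) * radInt q)
        = 2 * π * √(speedSq v q) * radInt q / angleInt v q := by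
      have hnq : (n : ℝ) * q * angleInt v q = 2 * π := by
        rw [mul_assoc, hq]
        field_simp
      rw [eq_div_iff h4.ne', ← hnq]
      ring
    rwa [h]

end Existence

/-! ### Cartesian equations of a rigidly moving profile -/

section RigidMotion

/-- The Cartesian coordinates of the profile of a curve that, under the binormal curvature flow,
rotates about the `z`-axis with angular velocity `Ω`, translates along it with velocity `V` and
slides along itself with velocity `C`. -/
structure IsRigidProfile (Ω V C : ℝ) (x y z : ℝ → ℝ) : Prop where
  smooth_x : ContDiff ℝ ∞ x
  smooth_y : ContDiff ℝ ∞ y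
  smooth_z : ContDiff ℝ ∞ z
  unit_speed : ∀ s, deriv x s ^ 2 + deriv y s ^ 2 + deriv z s ^ 2 = 1
  second_x : ∀ s, deriv (deriv x) s = Ω * deriv z s * x s - V * deriv y s
  second_y : ∀ s, deriv (deriv y) s = Ω * deriv z s * y s + V * deriv x s
  second_z : ∀ s, deriv (deriv z) s = -(Ω * (x s * deriv x s + y s * deriv y s))
  slide : ∀ s, Ω * (x s * deriv y s - y s * deriv x s) + V * deriv z s = C

/-- With `w = x + i y`, `a = u'/(2u)` and `b = θ'`, one has `w' = (a + i b) w`. The horizontal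
equations become `w'' = Ω z' w + i V w'`, that is, `a' + a² - b² = Ω z' - V b` and `b' + 2ab = V a`.
The first combines acceleration and energy; the second follows from the formula for `θ'`. -/
theorem IsHelicalProfile.isRigidProfile {Ω V K M s₀ δ : ℝ} {u θ z : ℝ → ℝ}
    (h : IsHelicalProfile Ω V K M s₀ δ u θ z) :
    IsRigidProfile Ω V (Ω * M + V * K) (fun s => √(u s) * cos (θ s))
      (fun s => √(u s) * sin (θ s)) z := by
  have hne : ∀ s, u s ≠ 0 := fun s => (h.pos s).ne'
  have hsm := h.smooth
  have hθs : ContDiff ℝ ∞ θ := contDiff_of_hasDerivAt_contDiff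
    (contDiff_const.add (contDiff_const.div h.smooth hne)) h.hasDerivAt_angle
  have hzs : ContDiff ℝ ∞ z := contDiff_of_hasDerivAt_contDiff (by fun_prop) h.hasDerivAt_height
  have hRs : ContDiff ℝ ∞ fun s => √(u s) := h.smooth.sqrt hne
  set x : ℝ → ℝ := fun s => √(u s) * cos (θ s) with hx
  set y : ℝ → ℝ := fun s => √(u s) * sin (θ s) with hy
  have hxs : ContDiff ℝ ∞ x := hRs.mul hθs.cos
  have hys : ContDiff ℝ ∞ y := hRs.mul hθs.sin
  have hu1 : ∀ s, HasDerivAt u (deriv u s) s := fun s =>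
    (h.smooth.differentiable (by simp) s).hasDerivAt
  have hu2 : ∀ s, HasDerivAt (deriv u) (deriv (deriv u) s) s := fun s =>
    ((contDiff_infty_iff_deriv.1 h.smooth).2.differentiable (by simp) s).hasDerivAt
  set a : ℝ → ℝ := fun s => deriv u s / (2 * u s) with ha
  set b : ℝ → ℝ := fun s => V / 2 + M / u s with hb
  have hsq : ∀ s, √(u s) ^ 2 = u s := fun s => sq_sqrt (h.pos s).le
  have hsp : ∀ s, 0 < √(u s) := fun s => sqrt_pos.2 (h.pos s)
  have hR' : ∀ s, HasDerivAt (fun s => √(u s)) (a s * √(u s)) s := by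
    intro s
    refine ((hu1 s).sqrt (hne s)).congr_deriv ?_
    have h1 := hsp s
    have h2 := hne s
    simp only [ha]
    field_simp
    linear_combination (-deriv u s) * hsq s
  have hx' : ∀ s, HasDerivAt x (a s * x s - b s * y s) s := fun s =>
    ((hR' s).mul (h.hasDerivAt_angle s).cos).congr_deriv (by simp only [hx, hy, hb]; ring)
  have hy' : ∀ s, HasDerivAt y (a s * y s + b s * x s) s := fun s =>
    ((hR' s).mul (h.hasDerivAt_angle s).sin).congr_deriv (by simp only [hx, hy, hb]; ring)
  have ha' : ∀ s, HasDerivAt a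
      (deriv (deriv u) s / (2 * u s) - deriv u s ^ 2 / (2 * u s ^ 2)) s := by
    intro s
    have h2 := hne s
    refine ((hu2 s).div ((hu1 s).const_mul 2) (by simpa using h2)).congr_deriv ?_
    field_simp
  have hb' : ∀ s, HasDerivAt b (-(M * deriv u s / u s ^ 2)) s := by
    intro s
    have h2 := hne s
    refine (((hasDerivAt_const s M).div (hu1 s) h2).const_add (V / 2)).congr_deriv ?_
    field_simp
    ring
  have dx : deriv x = fun s => a s * x s - b s * y s := funext fun s => (hx' s).deriv
  have dy : deriv y = fun s => a s * y s + b s * x s := funext fun s => (hy' s).deriv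
  have dz : deriv z = fun s => K - Ω * u s / 2 := funext fun s => (h.hasDerivAt_height s).deriv
  have hxy : ∀ s, x s ^ 2 + y s ^ 2 = u s := fun s => by
    simp only [hx, hy]
    linear_combination √(u s) ^ 2 * sin_sq_add_cos_sq (θ s) + hsq s
  have hre : ∀ s, deriv (deriv u) s / (2 * u s) - deriv u s ^ 2 / (2 * u s ^ 2) + a s ^ 2 - b s ^ 2
      = Ω * (K - Ω * u s / 2) - V * b s := by
    intro s
    have h2 := hne s
    simp only [ha, hb]
    field_simp
    rw [h.acceleration s]
    linear_combination -h.energy s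
  have him : ∀ s, -(M * deriv u s / u s ^ 2) + 2 * a s * b s = V * a s := by
    intro s
    have h2 := hne s
    simp only [ha, hb]
    field_simp
    ring
  refine ⟨hxs, hys, hzs, fun s => ?_, fun s => ?_, fun s => ?_, fun s => ?_, fun s => ?_⟩
  · have h3 : (a s ^ 2 + b s ^ 2) * u s + (K - Ω * u s / 2) ^ 2 = 1 := by
      have h2 := hne s
      simp only [ha, hb]
      field_simp
      linear_combination h.energy s
    rw [dx, dy, dz]
    linear_combination (a s ^ 2 + b s ^ 2) * hxy s + h3
  · have h3 : HasDerivAt (fun s => a s * x s - b s * y s) _ s :=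
      ((ha' s).mul (hx' s)).sub ((hb' s).mul (hy' s))
    rw [dx, h3.deriv, dy, dz]
    linear_combination x s * hre s - y s * him s
  · have h3 : HasDerivAt (fun s => a s * y s + b s * x s) _ s :=
      ((ha' s).mul (hy' s)).add ((hb' s).mul (hx' s))
    rw [dy, h3.deriv, dx, dz]
    linear_combination y s * hre s + x s * him s
  · rw [dz, dx, dy, ((((hu1 s).const_mul Ω).div_const 2).const_sub K).deriv]
    have h2 : 2 * a s * u s = deriv u s := by
      have := hne s
      simp only [ha]
      field_simp
    linear_combination Ω * a s * hxy s + Ω / 2 * h2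
  · have h2 : b s * u s = V * u s / 2 + M := by
      have := hne s
      simp only [hb]
      field_simp
    rw [dz, dx, dy]
    linear_combination Ω * b s * hxy s + Ω * h2

end RigidMotion

/-! ### Orthonormal frames and vector products -/

section Frame

/-- A right-handed orthonormal frame of `ℝ³`. -/
structure IsFrame (f₁ f₂ f₃ : E3) : Prop where
  norm₁ : ‖f₁‖ = 1
  norm₂ : ‖f₂‖ = 1
  norm₃ : ‖f₃‖ = 1
  inner₁₂ : ⟪f₁, f₂⟫_ℝ = 0
  inner₁₃ : ⟪f₁, f₃⟫_ℝ = 0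
  inner₂₃ : ⟪f₂, f₃⟫_ℝ = 0
  cross₁₂ : cross f₁ f₂ = f₃
  cross₂₃ : cross f₂ f₃ = f₁
  cross₃₁ : cross f₃ f₁ = f₂

/-- The vector with coordinates `a`, `b`, `c` in a frame. -/
def combo (f₁ f₂ f₃ : E3) (a b c : ℝ) : E3 := a • f₁ + b • f₂ + c • f₃

theorem inner_eq (x y : E3) : ⟪x, y⟫_ℝ = x 0 * y 0 + x 1 * y 1 + x 2 * y 2 := by
  simp [PiLp.inner_apply, Fin.sum_univ_three, mul_comm]

theorem normSq_eq (x : E3) : ‖x‖ ^ 2 = x 0 ^ 2 + x 1 ^ 2 + x 2 ^ 2 := by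
  rw [EuclideanSpace.real_norm_sq_eq, Fin.sum_univ_three]

theorem cross_ext {x y w : E3} (h0 : x 1 * y 2 - x 2 * y 1 = w 0)
    (h1 : x 2 * y 0 - x 0 * y 2 = w 1) (h2 : x 0 * y 1 - x 1 * y 0 = w 2) : cross x y = w := by
  ext i
  fin_cases i <;> simp [cross, cross_apply, h0, h1, h2]

theorem cross_apply_zero (x y : E3) : cross x y 0 = x 1 * y 2 - x 2 * y 1 := by
  simp [cross, cross_apply]

theorem cross_apply_one (x y : E3) : cross x y 1 = x 2 * y 0 - x 0 * y 2 := by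
  simp [cross, cross_apply]

theorem cross_apply_two (x y : E3) : cross x y 2 = x 0 * y 1 - x 1 * y 0 := by
  simp [cross, cross_apply]

theorem IsFrame.cross_combo {f₁ f₂ f₃ : E3} (hf : IsFrame f₁ f₂ f₃) (a b c a' b' c' : ℝ) :
    cross (combo f₁ f₂ f₃ a b c) (combo f₁ f₂ f₃ a' b' c')
      = combo f₁ f₂ f₃ (b * c' - c * b') (c * a' - a * c') (a * b' - b * a') := by
  have h1 : (b * c' - c * b') • f₁ = (b * c' - c * b') • cross f₂ f₃ := by rw [hf.cross₂₃]
  have h2 : (c * a' - a * c') • f₂ = (c * a' - a * c') • cross f₃ f₁ := by rw [hf.cross₃₁]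
  have h3 : (a * b' - b * a') • f₃ = (a * b' - b * a') • cross f₁ f₂ := by rw [hf.cross₁₂]
  have h : combo f₁ f₂ f₃ (b * c' - c * b') (c * a' - a * c') (a * b' - b * a')
      = (b * c' - c * b') • cross f₂ f₃ + (c * a' - a * c') • cross f₃ f₁
        + (a * b' - b * a') • cross f₁ f₂ := by
    rw [combo, h1, h2, h3]
  rw [h]
  apply cross_ext <;>
    simp only [combo, PiLp.add_apply, PiLp.smul_apply, smul_eq_mul, cross_apply_zero,
      cross_apply_one, cross_apply_two] <;> ring

theorem IsFrame.norm_combo_sq {f₁ f₂ f₃ : E3} (hf : IsFrame f₁ f₂ f₃) (a b c : ℝ) :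
    ‖combo f₁ f₂ f₃ a b c‖ ^ 2 = a ^ 2 + b ^ 2 + c ^ 2 := by
  have n1 : ⟪f₁, f₁⟫_ℝ = 1 := by rw [real_inner_self_eq_norm_sq, hf.norm₁]; norm_num
  have n2 : ⟪f₂, f₂⟫_ℝ = 1 := by rw [real_inner_self_eq_norm_sq, hf.norm₂]; norm_num
  have n3 : ⟪f₃, f₃⟫_ℝ = 1 := by rw [real_inner_self_eq_norm_sq, hf.norm₃]; norm_num
  rw [← real_inner_self_eq_norm_sq, combo]
  simp only [inner_add_left, inner_add_right, real_inner_smul_left, real_inner_smul_right,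
    n1, n2, n3, hf.inner₁₂, hf.inner₁₃, hf.inner₂₃, real_inner_comm f₁ f₂, real_inner_comm f₁ f₃,
    real_inner_comm f₂ f₃]
  ring

/-- A unit vector orthogonal to the unit vector `e` is part of a frame with last vector `e`. -/
theorem isFrame_of_orthogonal {f e : E3} (hf : ‖f‖ = 1) (he : ‖e‖ = 1) (h : ⟪f, e⟫_ℝ = 0) :
    IsFrame f (cross e f) e := by
  have hf' := normSq_eq f
  have he' := normSq_eq e
  rw [hf] at hf'
  rw [he] at he'
  rw [inner_eq] at h
  have hn : ‖cross e f‖ ^ 2 = 1 := by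
    rw [normSq_eq, cross_apply_zero, cross_apply_one, cross_apply_two]
    linear_combination (-(f 0 * e 0 + f 1 * e 1 + f 2 * e 2)) * h
      - (e 0 ^ 2 + e 1 ^ 2 + e 2 ^ 2) * hf' - he'
  refine ⟨hf, ?_, he, ?_, ?_, ?_, ?_, ?_, rfl⟩
  · nlinarith [norm_nonneg (cross e f)]
  · rw [inner_eq, cross_apply_zero, cross_apply_one, cross_apply_two]
    ring
  · rw [inner_eq, h]
  · rw [inner_eq, cross_apply_zero, cross_apply_one, cross_apply_two]
    ring
  · apply cross_ext <;> simp only [cross_apply_zero, cross_apply_one, cross_apply_two]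
    · linear_combination (-e 0) * hf' - f 0 * h
    · linear_combination (-e 1) * hf' - f 1 * h
    · linear_combination (-e 2) * hf' - f 2 * h
  · apply cross_ext <;> simp only [cross_apply_zero, cross_apply_one, cross_apply_two]
    · linear_combination (-f 0) * he' - e 0 * h
    · linear_combination (-f 1) * he' - e 1 * h
    · linear_combination (-f 2) * he' - e 2 * h

theorem hasDerivAt_combo (f₁ f₂ f₃ : E3) {a b c : ℝ → ℝ} {a' b' c' s : ℝ} (ha : HasDerivAt a a' s)
    (hb : HasDerivAt b b' s) (hc : HasDerivAt c c' s) :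
    HasDerivAt (fun s => combo f₁ f₂ f₃ (a s) (b s) (c s)) (combo f₁ f₂ f₃ a' b' c') s :=
  ((ha.smul_const f₁).add (hb.smul_const f₂)).add (hc.smul_const f₃)

end Frame

/-! ### Rigid motions solve the flow -/

section RigidCurve

/-- The rigid motion, in the frame `f₁, f₂, f₃`, of the profile `(x, y, z)` scaled by `r`. -/
def rigidCurve (p f₁ f₂ f₃ : E3) (r Ω V C : ℝ) (x y z : ℝ → ℝ) (t s : ℝ) : E3 :=
  p + combo f₁ f₂ f₃
    (r * (cos (Ω * (t / r ^ 2)) * x (s / r - C * (t / r ^ 2))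
      - sin (Ω * (t / r ^ 2)) * y (s / r - C * (t / r ^ 2))))
    (r * (sin (Ω * (t / r ^ 2)) * x (s / r - C * (t / r ^ 2))
      + cos (Ω * (t / r ^ 2)) * y (s / r - C * (t / r ^ 2))))
    (r * (z (s / r - C * (t / r ^ 2)) + V * (t / r ^ 2)))

theorem contDiff_combo {E : Type*} [NormedAddCommGroup E] [NormedSpace ℝ E] (f₁ f₂ f₃ : E3)
    {a b c : E → ℝ} (ha : ContDiff ℝ ∞ a) (hb : ContDiff ℝ ∞ b) (hc : ContDiff ℝ ∞ c) :
    ContDiff ℝ ∞ fun p => combo f₁ f₂ f₃ (a p) (b p) (c p) :=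
  ((ha.smul contDiff_const).add (hb.smul contDiff_const)).add (hc.smul contDiff_const)

theorem contDiff_rigidCurve (p f₁ f₂ f₃ : E3) {r : ℝ} (Ω V C : ℝ) {x y z : ℝ → ℝ}
    (hx : ContDiff ℝ ∞ x) (hy : ContDiff ℝ ∞ y) (hz : ContDiff ℝ ∞ z) :
    ContDiff ℝ ∞ fun w : ℝ × ℝ => rigidCurve p f₁ f₂ f₃ r Ω V C x y z w.1 w.2 := by
  have hσ : ContDiff ℝ ∞ fun w : ℝ × ℝ => w.2 / r - C * (w.1 / r ^ 2) := by fun_prop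
  have hΩ : ContDiff ℝ ∞ fun w : ℝ × ℝ => Ω * (w.1 / r ^ 2) := by fun_prop
  have hx' := hx.comp hσ
  have hy' := hy.comp hσ
  have hz' := hz.comp hσ
  refine contDiff_const.add (contDiff_combo _ _ _ ?_ ?_ ?_)
  · exact contDiff_const.mul ((hΩ.cos.mul hx').sub (hΩ.sin.mul hy'))
  · exact contDiff_const.mul ((hΩ.sin.mul hx').add (hΩ.cos.mul hy'))
  · exact contDiff_const.mul (hz'.add (by fun_prop))

/-- In the moving frame the flow reads `Ω e₃ × X + V e₃ - C X' = X' × X''`. Its tangential part is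
the `slide` identity, and its normal part is `X'' = (Ω e₃ × X + V e₃) × X'`, which the three
second-order equations express. Scaling by `r` rescales arc-length by `r` and time by `r²`. -/
theorem IsRigidProfile.isSmoothSolution {p f₁ f₂ f₃ : E3} (hf : IsFrame f₁ f₂ f₃) {r : ℝ}
    (hr : 0 < r) {Ω V C : ℝ} {x y z : ℝ → ℝ} (h : IsRigidProfile Ω V C x y z) {L : ℝ}
    (hx : Function.Periodic x L) (hy : Function.Periodic y L) (hz : Function.Periodic z L) :
    IsSmoothSolution (r * L) (rigidCurve p f₁ f₂ f₃ r Ω V C x y z) := by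
  have hderiv : ∀ {g : ℝ → ℝ}, ContDiff ℝ ∞ g → ∀ s, HasDerivAt g (deriv g s) s := fun hg s =>
    (hg.differentiable (by simp) s).hasDerivAt
  have hσ : ∀ {g : ℝ → ℝ}, ContDiff ℝ ∞ g → ∀ d s,
      HasDerivAt (fun s => g (s / r - d)) (deriv g (s / r - d) / r) s := by
    intro g hg d s
    have h1 : HasDerivAt (fun s => s / r - d) (1 / r) s :=
      ((hasDerivAt_id s).div_const r).sub_const d
    exact ((hderiv hg _).comp s h1).congr_deriv (by ring)
  have hτ : ∀ {g : ℝ → ℝ}, ContDiff ℝ ∞ g → ∀ s t, HasDerivAt (fun t => g (s - C * (t / r ^ 2)))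
      (-(C / r ^ 2 * deriv g (s - C * (t / r ^ 2)))) t := by
    intro g hg s t
    have h1 : HasDerivAt (fun t => s - C * (t / r ^ 2)) (-(C * (1 / r ^ 2))) t :=
      (((hasDerivAt_id t).div_const (r ^ 2)).const_mul C).const_sub s
    exact ((hderiv hg _).comp t h1).congr_deriv (by ring)
  have hsmooth' : ∀ {g : ℝ → ℝ}, ContDiff ℝ ∞ g → ContDiff ℝ ∞ (deriv g) := fun hg =>
    (contDiff_infty_iff_deriv.1 hg).2
  have hds : ∀ t, deriv (rigidCurve p f₁ f₂ f₃ r Ω V C x y z t) = fun s => combo f₁ f₂ f₃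
      (cos (Ω * (t / r ^ 2)) * deriv x (s / r - C * (t / r ^ 2))
        - sin (Ω * (t / r ^ 2)) * deriv y (s / r - C * (t / r ^ 2)))
      (sin (Ω * (t / r ^ 2)) * deriv x (s / r - C * (t / r ^ 2))
        + cos (Ω * (t / r ^ 2)) * deriv y (s / r - C * (t / r ^ 2)))
      (deriv z (s / r - C * (t / r ^ 2))) := by
    intro t
    ext1 s
    have hX := hσ h.smooth_x (C * (t / r ^ 2)) s
    have hY := hσ h.smooth_y (C * (t / r ^ 2)) s
    have hZ := hσ h.smooth_z (C * (t / r ^ 2)) s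
    refine HasDerivAt.deriv ((hasDerivAt_combo f₁ f₂ f₃ (HasDerivAt.congr_deriv
      (((hX.const_mul (cos (Ω * (t / r ^ 2)))).sub (hY.const_mul (sin (Ω * (t / r ^ 2))))).const_mul
        r) ?_) (HasDerivAt.congr_deriv
      (((hX.const_mul (sin (Ω * (t / r ^ 2)))).add (hY.const_mul (cos (Ω * (t / r ^ 2))))).const_mul
        r) ?_) (HasDerivAt.congr_deriv ((hZ.add_const _).const_mul r) ?_)).const_add p)
    all_goals field_simp
  have hdds : ∀ t s, deriv (deriv (rigidCurve p f₁ f₂ f₃ r Ω V C x y z t)) s = combo f₁ f₂ f₃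
      ((cos (Ω * (t / r ^ 2)) * deriv (deriv x) (s / r - C * (t / r ^ 2))
        - sin (Ω * (t / r ^ 2)) * deriv (deriv y) (s / r - C * (t / r ^ 2))) / r)
      ((sin (Ω * (t / r ^ 2)) * deriv (deriv x) (s / r - C * (t / r ^ 2))
        + cos (Ω * (t / r ^ 2)) * deriv (deriv y) (s / r - C * (t / r ^ 2))) / r)
      (deriv (deriv z) (s / r - C * (t / r ^ 2)) / r) := by
    intro t s
    rw [hds t]
    have hX := hσ (hsmooth' h.smooth_x) (C * (t / r ^ 2)) s
    have hY := hσ (hsmooth' h.smooth_y) (C * (t / r ^ 2)) s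
    have hZ := hσ (hsmooth' h.smooth_z) (C * (t / r ^ 2)) s
    refine HasDerivAt.deriv (hasDerivAt_combo f₁ f₂ f₃ (HasDerivAt.congr_deriv
      ((hX.const_mul (cos (Ω * (t / r ^ 2)))).sub (hY.const_mul (sin (Ω * (t / r ^ 2))))) ?_)
      (HasDerivAt.congr_deriv
      ((hX.const_mul (sin (Ω * (t / r ^ 2)))).add (hY.const_mul (cos (Ω * (t / r ^ 2))))) ?_) hZ)
    all_goals ring
  refine ⟨contDiff_rigidCurve p f₁ f₂ f₃ Ω V C h.smooth_x h.smooth_y h.smooth_z, ?_, ?_, ?_⟩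
  · intro t s
    have h1 : (s + r * L) / r - C * (t / r ^ 2) = s / r - C * (t / r ^ 2) + L := by
      field_simp
      ring
    simp only [rigidCurve, h1, hx (s / r - C * (t / r ^ 2)), hy (s / r - C * (t / r ^ 2)),
      hz (s / r - C * (t / r ^ 2))]
  · intro t s
    rw [hds]
    have h1 : ‖combo f₁ f₂ f₃ (cos (Ω * (t / r ^ 2)) * deriv x (s / r - C * (t / r ^ 2))
        - sin (Ω * (t / r ^ 2)) * deriv y (s / r - C * (t / r ^ 2)))
      (sin (Ω * (t / r ^ 2)) * deriv x (s / r - C * (t / r ^ 2))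
        + cos (Ω * (t / r ^ 2)) * deriv y (s / r - C * (t / r ^ 2)))
      (deriv z (s / r - C * (t / r ^ 2)))‖ ^ 2 = 1 := by
      rw [hf.norm_combo_sq]
      set σ := s / r - C * (t / r ^ 2)
      linear_combination h.unit_speed σ + (deriv x σ ^ 2 + deriv y σ ^ 2)
        * sin_sq_add_cos_sq (Ω * (t / r ^ 2))
    exact (pow_eq_one_iff_of_nonneg (norm_nonneg _) two_ne_zero).1 h1
  · intro t s
    rw [hdds, hds, hf.cross_combo]
    have hX := hτ h.smooth_x (s / r) t
    have hY := hτ h.smooth_y (s / r) t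
    have hZ := hτ h.smooth_z (s / r) t
    have hΩ : HasDerivAt (fun t => Ω * (t / r ^ 2)) (Ω * (1 / r ^ 2)) t :=
      ((hasDerivAt_id t).div_const (r ^ 2)).const_mul Ω
    have hVt : HasDerivAt (fun t => V * (t / r ^ 2)) (V * (1 / r ^ 2)) t :=
      ((hasDerivAt_id t).div_const (r ^ 2)).const_mul V
    have hu := h.unit_speed (s / r - C * (t / r ^ 2))
    have hc := h.slide (s / r - C * (t / r ^ 2))
    have hcs := sin_sq_add_cos_sq (Ω * (t / r ^ 2))
    refine HasDerivAt.deriv ((hasDerivAt_combo f₁ f₂ f₃ (HasDerivAt.congr_deriv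
      (((hΩ.cos.mul hX).sub (hΩ.sin.mul hY)).const_mul r) ?_) (HasDerivAt.congr_deriv
      (((hΩ.sin.mul hX).add (hΩ.cos.mul hY)).const_mul r) ?_)
      (HasDerivAt.congr_deriv ((hZ.add hVt).const_mul r) ?_)).const_add p)
    all_goals
      rw [h.second_x, h.second_y]
      try rw [h.second_z]
      generalize deriv x (s / r - C * (t / r ^ 2)) = x' at *
      generalize deriv y (s / r - C * (t / r ^ 2)) = y' at *
      generalize deriv z (s / r - C * (t / r ^ 2)) = z' at *
      generalize x (s / r - C * (t / r ^ 2)) = X at *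
      generalize y (s / r - C * (t / r ^ 2)) = Y at *
      generalize cos (Ω * (t / r ^ 2)) = c at *
      generalize sin (Ω * (t / r ^ 2)) = σ at *
      field_simp
    · linear_combination c * (Ω * Y * hu + x' * hc) - σ * (-Ω * X * hu + y' * hc)
    · linear_combination σ * (Ω * Y * hu + x' * hc) + c * (-Ω * X * hu + y' * hc)
    · linear_combination -V * hu + z' * hc
        - (x' * (Ω * z' * Y + V * x') - y' * (Ω * z' * X - V * y')) * hcs

end RigidCurve

/-! ### Uniform distance between the coil and the circle -/

section Approximation

/-- A periodic function that vanishes at `0` is bounded by the product of its period and a bound of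
its derivative. -/
theorem abs_le_of_periodic {D D' : ℝ → ℝ} {s₀ B : ℝ} (hs₀ : 0 < s₀) (hD : Function.Periodic D s₀)
    (h0 : D 0 = 0) (hderiv : ∀ s, HasDerivAt D (D' s) s) (hB : ∀ s, |D' s| ≤ B) (s : ℝ) :
    |D s| ≤ B * s₀ := by
  obtain ⟨y, ⟨hy0, hy1⟩, hy⟩ := hD.exists_mem_Ico₀ hs₀ s
  have hB0 : 0 ≤ B := (abs_nonneg _).trans (hB 0)
  have h := convex_univ.norm_image_sub_le_of_norm_hasDerivWithin_le (f := D) (f' := D') (C := B)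
    (fun x _ => (hderiv x).hasDerivWithinAt) (fun x _ => hB x) (Set.mem_univ 0) (Set.mem_univ y)
  rw [h0, sub_zero, sub_zero, Real.norm_eq_abs, Real.norm_eq_abs, abs_of_nonneg hy0] at h
  rw [hy]
  exact h.trans (mul_le_mul_of_nonneg_left hy1.le hB0)

/-- The point with angle `β` and height `h` on the cylinder of radius `r` about the axis through `p`
in the direction `f₃`. -/
def cylPoint (p f₁ f₂ f₃ : E3) (r h β : ℝ) : E3 := p + combo f₁ f₂ f₃ (r * cos β) (r * sin β) h

theorem IsFrame.norm_combo_le {f₁ f₂ f₃ : E3} (hf : IsFrame f₁ f₂ f₃) (a b c : ℝ) :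
    ‖combo f₁ f₂ f₃ a b c‖ ≤ |a| + |b| + |c| := by
  refine (norm_add_le _ _).trans (add_le_add ((norm_add_le _ _).trans (add_le_add ?_ ?_)) ?_)
  · rw [norm_smul, hf.norm₁, mul_one, Real.norm_eq_abs]
  · rw [norm_smul, hf.norm₂, mul_one, Real.norm_eq_abs]
  · rw [norm_smul, hf.norm₃, mul_one, Real.norm_eq_abs]

theorem abs_mul_cos_sub_cos_le (R A B : ℝ) : |R * cos A - cos B| ≤ |R - 1| + |A - B| := by
  have h : R * cos A - cos B = (R - 1) * cos A + (cos A - cos B) := by ring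
  rw [h]
  refine (abs_add_le _ _).trans (add_le_add ?_ (abs_cos_sub_cos_le A B))
  rw [abs_mul]
  exact mul_le_of_le_one_right (abs_nonneg _) (abs_cos_le_one A)

theorem abs_mul_sin_sub_sin_le (R A B : ℝ) : |R * sin A - sin B| ≤ |R - 1| + |A - B| := by
  have h : R * sin A - sin B = (R - 1) * sin A + (sin A - sin B) := by ring
  rw [h]
  refine (abs_add_le _ _).trans (add_le_add ?_ (abs_sin_sub_sin_le A B))
  rw [abs_mul]
  exact mul_le_of_le_one_right (abs_nonneg _) (abs_sin_le_one A)

theorem abs_sqrt_sub_one_le {a : ℝ} (ha : 0 ≤ a) : |√a - 1| ≤ |a - 1| := by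
  have h : a - 1 = (√a - 1) * (√a + 1) := by
    linear_combination -(sq_sqrt ha)
  rw [h, abs_mul]
  refine le_mul_of_one_le_right (abs_nonneg _) ?_
  rw [abs_of_nonneg (by positivity)]
  linarith [sqrt_nonneg a]

/-- Nonnegativity of `u'²` in the energy equation forces `|z'| ≤ 1`, and `z` is periodic and
vanishes at 0. -/
theorem IsHelicalProfile.abs_height_le {Ω V K M s₀ δ : ℝ} {u θ z : ℝ → ℝ}
    (h : IsHelicalProfile Ω V K M s₀ δ u θ z) (hs₀ : 0 < s₀) (s : ℝ) : |z s| ≤ s₀ := by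
  have hB : ∀ s, |K - Ω * u s / 2| ≤ 1 := by
    intro s
    rw [abs_le_one_iff_mul_self_le_one]
    have h1 := h.energy s
    have h2 := h.pos s
    have h3 : 0 ≤ u s * (1 - (K - Ω * u s / 2) ^ 2) := by
      nlinarith [sq_nonneg (deriv u s), sq_nonneg (V * u s / 2 + M)]
    nlinarith [nonneg_of_mul_nonneg_right h3 h2]
  simpa using abs_le_of_periodic hs₀ h.periodic_height h.height_zero h.hasDerivAt_height hB s

/-- The energy equation gives `u θ'² ≤ 1`, hence `θ'² ≤ 2`. -/
theorem IsHelicalProfile.abs_angle_deriv_le {Ω V K M s₀ δ : ℝ} {u θ z : ℝ → ℝ}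
    (h : IsHelicalProfile Ω V K M s₀ δ u θ z) {s : ℝ} (hu : 1 / 2 ≤ u s) :
    |V / 2 + M / u s| ≤ 2 := by
  have h2 := h.pos s
  have h4 : V * u s / 2 + M = (V / 2 + M / u s) * u s := by field_simp
  have h1 := h.energy s
  rw [h4] at h1
  have h3 : 0 ≤ u s * (1 - (V / 2 + M / u s) ^ 2 * u s) := by
    nlinarith [sq_nonneg (deriv u s), mul_nonneg h2.le (sq_nonneg (K - Ω * u s / 2))]
  have h5 := nonneg_of_mul_nonneg_right h3 h2
  refine abs_le_of_sq_le_sq ?_ (by norm_num)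
  nlinarith [sq_nonneg (V / 2 + M / u s)]

/-- There are closed binormal curvature flows that stay close to a circle of radius `r` which travels
with velocity `slowFactor m / r`, and whose length is close to `2 π m r`. -/
theorem exists_solution_near (p : E3) {f₁ f₂ f₃ : E3} (hf : IsFrame f₁ f₂ f₃) {r : ℝ} (hr : 0 < r)
    {m : ℝ} (hm : 1 < m) {ε : ℝ} (hε : 0 < ε) (hε' : ε ≤ 1 / 2) :
    ∃ (L : ℝ) (γ : ℝ → ℝ → E3), 1 ≤ L ∧ |L - 2 * π * m| < ε ∧ IsSmoothSolution (r * L) γ ∧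
      ∀ t, ∃ α, ∀ s, ‖γ t s - cylPoint p f₁ f₂ f₃ r (slowFactor m * t / r)
        (2 * π / (r * L) * s + α)‖ ≤ r * ε * (25 + |t / r ^ 2|) := by
  obtain ⟨Ω, V, K, M, s₀, n, u, θ, z, hn, hs₀, h, hs₀ε, hL, hV, hu⟩ :=
    exists_isHelicalProfile_near hm hε
  set L : ℝ := n * s₀ with hLdef
  have hnpos : (0 : ℝ) < n := by exact_mod_cast hn
  have hL1 : 1 ≤ L := by
    have h1 := (abs_lt.1 hL).1
    nlinarith [pi_gt_three]
  have hLpos : 0 < L := by linarith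
  have hθL : ∀ s, θ (s + L) = θ s + 2 * π := by
    have key : ∀ (k : ℕ) s, θ (s + k * s₀) = θ s + k * (2 * π / n) := by
      intro k
      induction k with
      | zero => simp
      | succ k ih =>
        intro s
        have h1 : s + ((k + 1 : ℕ) : ℝ) * s₀ = s + k * s₀ + s₀ := by push_cast; ring
        rw [h1, h.angle_add, ih]
        push_cast
        ring
    intro s
    rw [hLdef, key n s]
    field_simp
  have huL : Function.Periodic u L := h.periodic.nat_mul n
  have hzL : Function.Periodic z L := h.periodic_height.nat_mul n
  refine ⟨L, rigidCurve p f₁ f₂ f₃ r Ω V (Ω * M + V * K) (fun s => √(u s) * cos (θ s))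
      (fun s => √(u s) * sin (θ s)) z, hL1, hL, h.isRigidProfile.isSmoothSolution hf hr
      (fun s => by simp only [huL s, hθL s, cos_add_two_pi])
      (fun s => by simp only [huL s, hθL s, sin_add_two_pi]) hzL, fun t => ?_⟩
  set C := Ω * M + V * K
  set τ := t / r ^ 2 with hτ
  -- The phase `α` absorbs the rotation and the sliding, neither of which is controlled as `ε` tends
  -- to 0.
  refine ⟨Ω * τ - 2 * π / L * (C * τ), fun s => ?_⟩
  set σ := s / r - C * τ with hσ
  -- As `L = n s₀`, both terms grow by `2π / n` over `s₀`, so the difference is periodic; its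
  -- derivative is at most `2 + 8`, from `L ≥ 1` and `π ≤ 4`.
  have hD : |θ σ - 2 * π / L * σ| ≤ 10 * s₀ := by
    refine abs_le_of_periodic (D := fun s => θ s - 2 * π / L * s)
      (D' := fun s => V / 2 + M / u s - 2 * π / L) hs₀ (fun s => ?_) ?_ (fun s => ?_)
      (fun s => ?_) σ
    · simp only [h.angle_add, hLdef]
      field_simp
      ring
    · simp [h.angle_zero]
    · exact ((h.hasDerivAt_angle s).sub ((hasDerivAt_id s).const_mul (2 * π / L))).congr_deriv
        (by simp)
    · refine (abs_sub _ _).trans ?_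
      have h1 : |V / 2 + M / u s| ≤ 2 :=
        h.abs_angle_deriv_le (by linarith [(abs_lt.1 (hu s)).1])
      have h2 : |2 * π / L| ≤ 8 := by
        rw [abs_of_pos (by positivity), div_le_iff₀ hLpos]
        nlinarith [pi_le_four]
      linarith
  have hR : |√(u σ) - 1| ≤ ε := (abs_sqrt_sub_one_le (h.pos σ).le).trans (hu σ).le
  have hang : θ σ + Ω * τ - (2 * π / (r * L) * s + (Ω * τ - 2 * π / L * (C * τ)))
      = θ σ - 2 * π / L * σ := by
    rw [hσ]
    field_simp
    ring
  set β := 2 * π / (r * L) * s + (Ω * τ - 2 * π / L * (C * τ)) with hβ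
  have hcos := abs_mul_cos_sub_cos_le (√(u σ)) (θ σ + Ω * τ) β
  have hsin := abs_mul_sin_sub_sin_le (√(u σ)) (θ σ + Ω * τ) β
  rw [hang] at hcos hsin
  have hz := h.abs_height_le hs₀ σ
  have hz' : |z σ + (V - slowFactor m) * τ| ≤ ε + ε * |τ| := by
    refine (abs_add_le _ _).trans (add_le_add (hz.trans hs₀ε.le) ?_)
    rw [abs_mul]
    exact mul_le_mul_of_nonneg_right hV.le (abs_nonneg _)
  have hdiff : rigidCurve p f₁ f₂ f₃ r Ω V C (fun s => √(u s) * cos (θ s))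
      (fun s => √(u s) * sin (θ s)) z t s - cylPoint p f₁ f₂ f₃ r (slowFactor m * t / r) β
      = combo f₁ f₂ f₃ (r * (√(u σ) * cos (θ σ + Ω * τ) - cos β))
        (r * (√(u σ) * sin (θ σ + Ω * τ) - sin β)) (r * (z σ + (V - slowFactor m) * τ)) := by
    have e1 : slowFactor m * t / r = r * (slowFactor m * τ) := by
      rw [hτ]
      field_simp
    rw [rigidCurve, cylPoint, e1, cos_add (θ σ), sin_add (θ σ)]
    simp only [combo, ← hτ, ← hσ]
    module
  rw [hdiff]
  refine (hf.norm_combo_le _ _ _).trans ?_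
  -- Each horizontal coordinate costs at most `ε + 10 ε` and the vertical one `ε + ε |τ|`, within
  -- the allowed `25 + |τ|`.
  rw [abs_mul, abs_mul, abs_mul, abs_of_pos hr, ← mul_add, ← mul_add, mul_assoc]
  refine mul_le_mul_of_nonneg_left ?_ hr.le
  linarith

end Approximation

/-! ### Work along nearby closed curves -/

section Comparison

/-- The work of a vector field along two closed curves that are close to each other. -/
theorem abs_work_sub_work_le {X : E3 → E3} (hX : ContDiff ℝ 1 X) {k : NNReal}
    (hk : LipschitzWith k X) {Z C Z' C' : ℝ → E3} (hZ : ∀ s, HasDerivAt Z (Z' s) s)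
    (hC : ∀ s, HasDerivAt C (C' s) s) (hZc : Continuous Z') (hCc : Continuous C') {ℓ η A B : ℝ}
    (hℓ : 0 ≤ ℓ) (hZℓ : Z ℓ = Z 0) (hCℓ : C ℓ = C 0) (hA : ∀ s, ‖Z' s‖ ≤ A)
    (hB : ∀ s, ‖C' s‖ ≤ B) (hη : ∀ s, ‖Z s - C s‖ ≤ η) :
    |(∫ s in (0 : ℝ)..ℓ, ⟪X (Z s), Z' s⟫_ℝ) - ∫ s in (0 : ℝ)..ℓ, ⟪X (C s), C' s⟫_ℝ|
      ≤ k * η * (A + B) * ℓ := by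
  have cZ : Continuous Z := continuous_iff_continuousAt.2 fun s => (hZ s).continuousAt
  have cC : Continuous C := continuous_iff_continuousAt.2 fun s => (hC s).continuousAt
  have cX : Continuous X := hX.continuous
  have cDX : Continuous (fderiv ℝ X) := hX.continuous_fderiv (by norm_num)
  have cD : Continuous fun s => fderiv ℝ X (C s) (C' s) := (cDX.comp cC).clm_apply hCc
  -- This derivative integrates to zero over the closed curves, which trades `Z' - C'`, not small,
  -- for `Z - C`.
  have hd : ∀ s, HasDerivAt (fun s => ⟪X (C s), Z s - C s⟫_ℝ)
      (⟪X (C s), Z' s - C' s⟫_ℝ + ⟪fderiv ℝ X (C s) (C' s), Z s - C s⟫_ℝ) s := by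
    intro s
    have h1 : HasDerivAt (fun s => X (C s)) (fderiv ℝ X (C s) (C' s)) s :=
      ((hX.differentiable (by norm_num)) (C s)).hasFDerivAt.comp_hasDerivAt s (hC s)
    exact h1.inner ℝ ((hZ s).sub (hC s))
  have hint := intervalIntegral.integral_eq_sub_of_hasDerivAt (a := 0) (b := ℓ)
    (fun s _ => hd s) (Continuous.intervalIntegrable (by fun_prop) _ _)
  rw [hZℓ, hCℓ, sub_self] at hint
  have heq : (∫ s in (0 : ℝ)..ℓ, ⟪X (Z s), Z' s⟫_ℝ) - ∫ s in (0 : ℝ)..ℓ, ⟪X (C s), C' s⟫_ℝ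
      = ∫ s in (0 : ℝ)..ℓ,
        (⟪X (Z s) - X (C s), Z' s⟫_ℝ - ⟪fderiv ℝ X (C s) (C' s), Z s - C s⟫_ℝ) := by
    rw [← intervalIntegral.integral_sub (Continuous.intervalIntegrable (by fun_prop) _ _)
      (Continuous.intervalIntegrable (by fun_prop) _ _), ← sub_eq_zero,
      ← intervalIntegral.integral_sub (Continuous.intervalIntegrable (by fun_prop) _ _)
      (Continuous.intervalIntegrable (by fun_prop) _ _), ← hint]
    congr 1
    ext s
    simp only [inner_sub_left, inner_sub_right]
    ring
  rw [heq]
  have hη0 : 0 ≤ η := (norm_nonneg _).trans (hη 0)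
  have hbound : ∀ s ∈ Set.uIoc 0 ℓ,
      ‖⟪X (Z s) - X (C s), Z' s⟫_ℝ - ⟪fderiv ℝ X (C s) (C' s), Z s - C s⟫_ℝ‖
        ≤ k * η * (A + B) := by
    intro s _
    have h1 : ‖X (Z s) - X (C s)‖ ≤ k * η := by
      have := hk.dist_le_mul (Z s) (C s)
      rw [dist_eq_norm, dist_eq_norm] at this
      exact this.trans (mul_le_mul_of_nonneg_left (hη s) k.2)
    have h2 : ‖fderiv ℝ X (C s) (C' s)‖ ≤ k * B :=
      (ContinuousLinearMap.le_opNorm _ _).trans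
        (mul_le_mul (norm_fderiv_le_of_lipschitz ℝ hk) (hB s) (norm_nonneg _) k.2)
    have h3 : ‖⟪X (Z s) - X (C s), Z' s⟫_ℝ‖ ≤ k * η * A := (norm_inner_le_norm _ _).trans
      (mul_le_mul h1 (hA s) (norm_nonneg _) (mul_nonneg k.2 hη0))
    have h4 : ‖⟪fderiv ℝ X (C s) (C' s), Z s - C s⟫_ℝ‖ ≤ k * B * η :=
      (norm_inner_le_norm _ _).trans
        (mul_le_mul h2 (hη s) (norm_nonneg _) (mul_nonneg k.2 ((norm_nonneg _).trans (hB s))))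
    refine (norm_sub_le _ _).trans ?_
    linarith
  have := intervalIntegral.norm_integral_le_of_norm_le_const hbound
  rwa [sub_zero, abs_of_nonneg hℓ] at this

theorem hasDerivAt_cylPoint (p f₁ f₂ f₃ : E3) (r h k α s : ℝ) :
    HasDerivAt (fun s => cylPoint p f₁ f₂ f₃ r h (k * s + α))
      (k • combo f₁ f₂ f₃ (-(r * sin (k * s + α))) (r * cos (k * s + α)) 0) s := by
  have h1 : HasDerivAt (fun s => k * s + α) k s := by
    simpa using ((hasDerivAt_id s).const_mul k).add_const α
  refine ((hasDerivAt_combo f₁ f₂ f₃ (h1.cos.const_mul r) (h1.sin.const_mul r)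
    (hasDerivAt_const s h)).const_add p).congr_deriv ?_
  simp only [combo]
  module

/-- The work of a vector field along a circle does not depend on the parametrization. -/
theorem work_cylPoint (X : E3 → E3) (p f₁ f₂ f₃ : E3) (r h : ℝ) {k ℓ : ℝ} (hk : k * ℓ = 2 * π)
    (α : ℝ) :
    ∫ s in (0 : ℝ)..ℓ, ⟪X (cylPoint p f₁ f₂ f₃ r h (k * s + α)),
      k • combo f₁ f₂ f₃ (-(r * sin (k * s + α))) (r * cos (k * s + α)) 0⟫_ℝ
    = ∫ β in (0 : ℝ)..(2 * π), ⟪X (cylPoint p f₁ f₂ f₃ r h β),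
      combo f₁ f₂ f₃ (-(r * sin β)) (r * cos β) 0⟫_ℝ := by
  set g : ℝ → ℝ := fun β => ⟪X (cylPoint p f₁ f₂ f₃ r h β),
      combo f₁ f₂ f₃ (-(r * sin β)) (r * cos β) 0⟫_ℝ with hg
  have hper : Function.Periodic g (2 * π) := fun β => by simp [hg, cylPoint]
  have h1 : ∀ s, ⟪X (cylPoint p f₁ f₂ f₃ r h (k * s + α)),
      k • combo f₁ f₂ f₃ (-(r * sin (k * s + α))) (r * cos (k * s + α)) 0⟫_ℝ = k * g (k * s + α) :=
    fun s => real_inner_smul_right _ _ _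
  simp_rw [h1]
  rw [intervalIntegral.integral_const_mul, intervalIntegral.mul_integral_comp_mul_add, hk,
    mul_zero, zero_add, add_comm, hper.intervalIntegral_add_eq α 0, zero_add]

end Comparison

/-! ### Explicit form of the traveling circle -/

section TravelingCircle

theorem cross_cross_left (a b c : E3) :
    cross (cross a b) c = ⟪a, c⟫_ℝ • b - ⟪b, c⟫_ℝ • a := by
  apply cross_ext <;>
    simp only [cross_apply_zero, cross_apply_one, cross_apply_two, inner_eq, PiLp.sub_apply,
      PiLp.smul_apply, smul_eq_mul] <;> ring

theorem cross_smul_left (k : ℝ) (a b : E3) : cross (k • a) b = k • cross a b := by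
  simp [cross]

theorem cross_sub_right (a b c : E3) : cross a (b - c) = cross a b - cross a c := by
  simp [cross]

theorem inner_cross_self (a b : E3) : ⟪b, cross a b⟫_ℝ = 0 := by
  rw [inner_eq, cross_apply_zero, cross_apply_one, cross_apply_two]
  ring

/-- A linear rotation field has at most one integral curve through a point. -/
theorem eq_of_hasDerivAt_cross {e : E3} {k : ℝ} {N P : ℝ → E3}
    (hN : ∀ s, HasDerivAt N (k • cross e (N s)) s) (hP : ∀ s, HasDerivAt P (k • cross e (P s)) s)
    (h0 : N 0 = P 0) (s : ℝ) : N s = P s := by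
  -- The squared distance is constant because `e ×` is skew-symmetric.
  have hw : ∀ s, HasDerivAt (fun s => ⟪N s - P s, N s - P s⟫_ℝ) 0 s := by
    intro s
    have h1 := (hN s).sub (hP s)
    refine (h1.inner ℝ h1).congr_deriv ?_
    have h2 : k • cross e (N s) - k • cross e (P s) = k • cross e (N s - P s) := by
      rw [cross_sub_right, smul_sub]
    simp only [Pi.sub_apply]
    rw [h2, real_inner_smul_right, real_inner_smul_left, real_inner_comm _ (cross e _), inner_cross_self]
    simp
  have hconst := is_const_of_deriv_eq_zero (fun s => (hw s).differentiableAt)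
    (fun s => (hw s).deriv) s 0
  simp only [h0, sub_self, inner_zero_left] at hconst
  exact sub_eq_zero.1 (inner_self_eq_zero.1 hconst)

theorem IsSmoothSolution.contDiff_curve {ℓ : ℝ} {γ : ℝ → ℝ → E3} (h : IsSmoothSolution ℓ γ)
    (t : ℝ) : ContDiff ℝ ∞ (γ t) :=
  h.smooth.comp (contDiff_const.prodMk contDiff_id)

theorem IsSmoothSolution.hasDerivAt {ℓ : ℝ} {γ : ℝ → ℝ → E3} (h : IsSmoothSolution ℓ γ)
    (t s : ℝ) : HasDerivAt (γ t) (deriv (γ t) s) s :=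
  ((h.contDiff_curve t).differentiable (by simp) s).hasDerivAt

theorem IsSmoothSolution.contDiff_tangent {ℓ : ℝ} {γ : ℝ → ℝ → E3} (h : IsSmoothSolution ℓ γ)
    (t : ℝ) : ContDiff ℝ ∞ (deriv (γ t)) :=
  (contDiff_infty_iff_deriv.1 (h.contDiff_curve t)).2

/-- The tangent of a traveling circle is determined by its direction of motion. -/
theorem IsSmoothSolution.tangent_eq_cross {ℓ r : ℝ} {γ : ℝ → ℝ → E3} (h : IsSmoothSolution ℓ γ)
    {c e : E3} (hmem : ∀ s, γ 0 s ∈ circle c e r)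
    (htrav : ∀ t s, γ t s = γ 0 s + (t / r) • e) (s : ℝ) :
    deriv (γ 0) s = (1 / r) • cross e (γ 0 s - c) := by
  have hN : ∀ s, HasDerivAt (fun s => γ 0 s - c) (deriv (γ 0) s) s := fun s =>
    (h.hasDerivAt 0 s).sub_const c
  have hD : ∀ s, HasDerivAt (deriv (γ 0)) (deriv (deriv (γ 0)) s) s := fun s =>
    ((h.contDiff_tangent 0).differentiable (by simp) s).hasDerivAt
  have h1 : ∀ s, ⟪deriv (γ 0) s, γ 0 s - c⟫_ℝ = 0 := by
    intro s
    have hd := (hN s).inner ℝ (hN s)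
    have hc : (fun s => ⟪γ 0 s - c, γ 0 s - c⟫_ℝ) = fun _ => r ^ 2 := by
      ext s
      rw [real_inner_self_eq_norm_sq, (hmem s).2]
    rw [hc] at hd
    have := hd.unique (hasDerivAt_const s (r ^ 2))
    rw [real_inner_comm (deriv (γ 0) s)] at this
    linarith
  have h2 : ⟪deriv (deriv (γ 0)) s, γ 0 s - c⟫_ℝ = -1 := by
    have hd := (hD s).inner ℝ (hN s)
    rw [show (fun s => ⟪deriv (γ 0) s, γ 0 s - c⟫_ℝ) = fun _ => 0 from funext h1] at hd
    have := hd.unique (hasDerivAt_const s 0)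
    rw [real_inner_self_eq_norm_sq, h.arclength] at this
    linarith
  have h3 : cross (deriv (γ 0) s) (deriv (deriv (γ 0)) s) = (1 / r) • e := by
    rw [← h.flow 0 s]
    have hd : HasDerivAt (fun τ : ℝ => γ 0 s + (τ / r) • e) ((1 / r) • e) 0 :=
      (((hasDerivAt_id (0 : ℝ)).div_const r).smul_const e).const_add _
    rw [show (fun τ => γ τ s) = fun τ => γ 0 s + (τ / r) • e from funext fun τ => htrav τ s]
    exact hd.deriv
  -- With `T` the tangent and `N = γ - c`, the relations `T · N = 0` and `T' · N = -1` reduce `(T ×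
  -- T') × N` to `T`, while the flow gives `T × T' = e / r`. This fixes the orientation.
  have h4 := cross_cross_left (deriv (γ 0) s) (deriv (deriv (γ 0)) s) (γ 0 s - c)
  rw [h3, h1 s, h2, cross_smul_left] at h4
  rw [h4]
  simp

/-- A traveling circle, explicitly. -/
theorem IsSmoothSolution.exists_eq_cylPoint {ℓ r : ℝ} {γ : ℝ → ℝ → E3}
    (h : IsSmoothSolution ℓ γ) (hr : 0 < r) (hcirc : IsTravelingCircle r γ) :
    ∃ p f₁ f₂ f₃ : E3, IsFrame f₁ f₂ f₃ ∧
      ∀ t s, γ t s = cylPoint p f₁ f₂ f₃ r (t / r) (1 / r * s + 0) := by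
  obtain ⟨c, e, he, hrange, htrav⟩ := hcirc
  have hmem : ∀ s, γ 0 s ∈ circle c e r := fun s => hrange ▸ Set.mem_range_self s
  have hf : IsFrame ((1 / r) • (γ 0 0 - c)) (cross e ((1 / r) • (γ 0 0 - c))) e := by
    refine isFrame_of_orthogonal ?_ he ?_
    · rw [norm_smul, (hmem 0).2, Real.norm_eq_abs, abs_of_pos (by positivity)]
      field_simp
    · rw [real_inner_smul_left, (hmem 0).1, mul_zero]
  set f₁ := (1 / r) • (γ 0 0 - c) with hf₁
  set f₂ := cross e f₁
  refine ⟨c, f₁, f₂, e, hf, fun t s => ?_⟩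
  have he' : e = combo f₁ f₂ e 0 0 1 := by simp [combo]
  have hP : ∀ s, HasDerivAt (fun s => cylPoint c f₁ f₂ e r 0 (1 / r * s + 0) - c)
      ((1 / r) • cross e (cylPoint c f₁ f₂ e r 0 (1 / r * s + 0) - c)) s := by
    intro s
    refine ((hasDerivAt_cylPoint c f₁ f₂ e r 0 (1 / r) 0 s).sub_const c).congr_deriv ?_
    have h1 : cross e (cylPoint c f₁ f₂ e r 0 (1 / r * s + 0) - c)
        = cross (combo f₁ f₂ e 0 0 1) (cylPoint c f₁ f₂ e r 0 (1 / r * s + 0) - c) := by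
      rw [← he']
    rw [h1, cylPoint, add_sub_cancel_left, hf.cross_combo]
    simp
  have hN : ∀ s, HasDerivAt (fun s => γ 0 s - c) ((1 / r) • cross e (γ 0 s - c)) s := fun s => by
    rw [← h.tangent_eq_cross hmem htrav s]
    exact (h.hasDerivAt 0 s).sub_const c
  have heq := eq_of_hasDerivAt_cross hN hP (by
    simp [cylPoint, combo, hf₁, smul_smul, hr.ne']) s
  have heq' : γ 0 s = cylPoint c f₁ f₂ e r 0 (1 / r * s + 0) := by
    simpa using heq
  rw [htrav, heq', cylPoint, cylPoint, combo, combo, zero_smul, add_zero, add_assoc c]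

end TravelingCircle

/-! ### From uniform closeness to closeness of currents -/

section Convergence

/-- The current of a solution close to a traveling circle is close to the current of the circle. -/
theorem abs_current_sub_le {f₁ f₂ f₃ : E3} (hf : IsFrame f₁ f₂ f₃) {p : E3} {r ℓ L h α η t : ℝ}
    (hr : 0 < r) (hL : 1 ≤ L) {Γ : ℝ → ℝ → E3} (hΓ : IsSmoothSolution (r * L) Γ)
    (hη : ∀ s, ‖Γ t s - cylPoint p f₁ f₂ f₃ r h (2 * π / (r * L) * s + α)‖ ≤ η)
    {γ : ℝ → ℝ → E3} {t' : ℝ} (hℓ : 1 / r * ℓ = 2 * π)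
    (hγ : ∀ s, γ t' s = cylPoint p f₁ f₂ f₃ r h (1 / r * s + 0)) {X : TestField} {k : NNReal}
    (hk : LipschitzWith k X) :
    |current (r * L) Γ t X - current ℓ γ t' X| ≤ k * η * (1 + 8) * (r * L) := by
  have hLpos : 0 < L := by linarith
  have hk' : 2 * π / (r * L) * (r * L) = 2 * π := by field_simp
  -- The circle is run through over the parameter interval of `Γ`, with phase `α`, so that the two
  -- curves can be compared pointwise.
  have htarget : current ℓ γ t' X = ∫ s in (0 : ℝ)..(r * L),
      ⟪X (cylPoint p f₁ f₂ f₃ r h (2 * π / (r * L) * s + α)),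
        (2 * π / (r * L)) • combo f₁ f₂ f₃ (-(r * sin (2 * π / (r * L) * s + α)))
          (r * cos (2 * π / (r * L) * s + α)) 0⟫_ℝ := by
    rw [work_cylPoint X p f₁ f₂ f₃ r h hk' α, ← work_cylPoint X p f₁ f₂ f₃ r h hℓ 0, current]
    congr 1
    ext s
    rw [show γ t' = fun s => cylPoint p f₁ f₂ f₃ r h (1 / r * s + 0) from funext hγ,
      (hasDerivAt_cylPoint p f₁ f₂ f₃ r h (1 / r) 0 s).deriv]
  rw [htarget, current]
  refine abs_work_sub_work_le (X.contDiff.of_le (by exact_mod_cast le_top)) hk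
    (C := fun s => cylPoint p f₁ f₂ f₃ r h (2 * π / (r * L) * s + α)) (fun s => hΓ.hasDerivAt t s)
    (fun s => hasDerivAt_cylPoint p f₁ f₂ f₃ r h _ α s) (hΓ.contDiff_tangent t).continuous ?_
    (by positivity) ?_ ?_ (fun s => (hΓ.arclength t s).le) ?_ hη
  · unfold combo
    fun_prop
  · simpa using hΓ.periodic t 0
  · simp only [hk', mul_zero, zero_add]
    rw [cylPoint, cylPoint, add_comm (2 * π), cos_add_two_pi, sin_add_two_pi]
  · intro s
    have h1 : ‖combo f₁ f₂ f₃ (-(r * sin (2 * π / (r * L) * s + α)))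
        (r * cos (2 * π / (r * L) * s + α)) 0‖ = r := by
      rw [← sq_eq_sq₀ (norm_nonneg _) hr.le, hf.norm_combo_sq]
      linear_combination r ^ 2 * sin_sq_add_cos_sq (2 * π / (r * L) * s + α)
    rw [norm_smul, h1, Real.norm_eq_abs, abs_of_pos (by positivity)]
    have h2 : 2 * π / (r * L) * r = 2 * π / L := by field_simp
    rw [h2, div_le_iff₀ hLpos]
    nlinarith [pi_le_four]

end Convergence

end BinormalFlow

end

/-- A circle of length `ℓ` traveling by the binormal curvature flow, slowed by the factor `a_m`, is,
for every `m > 1`, a limit in the sense of distributions of smooth binormal curvature flows of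
closed curves whose lengths tend to `m ℓ`. -/
theorem mainTheorem11 (ℓ : ℝ) (hℓ : 0 < ℓ) (γ : ℝ → ℝ → BinormalFlow.E3)
    (hsol : BinormalFlow.IsSmoothSolution ℓ γ)
    (hcirc : BinormalFlow.IsTravelingCircle (ℓ / (2 * Real.pi)) γ)
    (m : ℝ) (hm : 1 < m) :
    ∃ (ℓn : ℕ → ℝ) (γn : ℕ → ℝ → ℝ → BinormalFlow.E3),
      (∀ n, 0 < ℓn n) ∧
      (∀ n, BinormalFlow.IsSmoothSolution (ℓn n) (γn n)) ∧
      Filter.Tendsto ℓn Filter.atTop (nhds (m * ℓ)) ∧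
      ∀ t : ℝ, BinormalFlow.TendstoDistrib
        (fun n => BinormalFlow.current (ℓn n) (γn n) t)
        (BinormalFlow.current ℓ γ (BinormalFlow.slowFactor m * t)) := by
  have hπ := Real.pi_pos
  set r := ℓ / (2 * Real.pi) with hr
  have hrpos : 0 < r := by positivity
  have hrℓ : 1 / r * ℓ = 2 * Real.pi := by rw [hr]; field_simp
  obtain ⟨p, f₁, f₂, f₃, hf, hγ⟩ := hsol.exists_eq_cylPoint hrpos hcirc
  set ε : ℕ → ℝ := fun n => 1 / 2 * (1 / ((n : ℝ) + 1)) with hε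
  have hεpos : ∀ n, 0 < ε n := fun n => by positivity
  have hεle : ∀ n, ε n ≤ 1 / 2 := fun n => by
    have h1 : 1 / ((n : ℝ) + 1) ≤ 1 := by
      rw [div_le_one (by positivity)]
      linarith [Nat.cast_nonneg (α := ℝ) n]
    simp only [hε]
    linarith
  have hεlim : Filter.Tendsto ε Filter.atTop (nhds 0) := by
    have h1 := (tendsto_one_div_add_atTop_nhds_zero_nat (𝕜 := ℝ)).const_mul (1 / 2)
    rwa [mul_zero] at h1
  choose L Γ hL1 hL hΓ hclose using fun n =>
    BinormalFlow.exists_solution_near p hf hrpos hm (hεpos n) (hεle n)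
  have hLlim : Filter.Tendsto L Filter.atTop (nhds (2 * Real.pi * m)) := by
    rw [tendsto_iff_dist_tendsto_zero]
    exact squeeze_zero (fun _ => dist_nonneg) (fun n => (hL n).le) hεlim
  refine ⟨fun n => r * L n, Γ, fun n => mul_pos hrpos (by linarith [hL1 n]), hΓ, ?_, fun t X => ?_⟩
  · have h1 : m * ℓ = r * (2 * Real.pi * m) := by rw [hr]; field_simp
    rw [h1]
    exact hLlim.const_mul r
  · obtain ⟨k, hk⟩ := ContDiff.lipschitzWith_of_hasCompactSupport X.hasCompactSupport
      (X.contDiff.of_le (by exact_mod_cast le_top)) one_ne_zero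
    rw [tendsto_iff_dist_tendsto_zero]
    refine squeeze_zero (g := fun n => k * (r * ε n * (25 + |t / r ^ 2|)) * (1 + 8) * (r * L n))
      (fun _ => dist_nonneg) (fun n => ?_) ?_
    · obtain ⟨α, hα⟩ := hclose n t
      exact BinormalFlow.abs_current_sub_le hf hrpos (hL1 n) (hΓ n) hα hrℓ (hγ _) hk
    · have h2 := ((((hεlim.const_mul r).mul_const (25 + |t / r ^ 2|)).const_mul (k : ℝ)).mul_const
        (1 + 8)).mul (hLlim.const_mul r)
      simpa using h2
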